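/- **Setting.** Let $G=(V,E,c)$ be a finite undirected graph with edge costs $c_e\ge 0$, and let $\mathrm{Pair}:V\to V$ be an involution (a Steiner Forest instance). Let $\mathrm{OPT}$ be a minimum-cost subgraph of $G$ in which every $v$ is connected to $\mathrm{Pair}(v)$, with the fewest edges among all such subgraphs of minimum cost (so $\mathrm{OPT}$ is a forest). Let $0<\beta<1$ and $t:V\to\mathbb R_{\ge 0}$. **Moat growing.** Time $\tau$ starts at $0$, and $y_A=0$ for all $A\subseteq V$. At every moment some of the connected components of the graph of fully coloured edges are *active sets*. The value $y_A$ of every active set $A$ grows at unit rate, all other values stay constant, and an edge $e$ becomes fully coloured when $\sum_{A:\,e\in\delta(A)}y_A=c_e$, where $\delta(A)$ is the set of edges with exactly one endpoint in $A$. Merges at a moment are carried out before deactivations at that moment. In *legacy moat growing* a component $A$ is active while it contains some $v$ with $\mathrm{Pair}(v)\notin A$; let $t^-_v$ be the first moment at which $v$ and $\mathrm{Pair}(v)$ are connected in it. In *boosted moat growing* on $(t,t^*)$, where $t^*\ge t$, a component $A$ is active at time $\tau$ iff $t^*_v>\tau$ for some $v\in A$; the growth of an active set $A$ at time $\tau$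 counts towards $y_{\mathrm{base}}$ if $t_v>\tau$ for some $v\in A$, and towards $y_{\mathrm{boost}}$ otherwise. **Local search.** A boost action $B=(v,\tau)$ replaces $t^*_v$ by $\tau$. Its win is the resulting decrease of $y_{\mathrm{base}}$ and its loss the resulting increase of $y_{\mathrm{boost}}$; it is valuable if $\mathrm{Win}\ge(1+\beta)\,\mathrm{Loss}$. The boost actions considered are those $(v,\tau)$ with $\tau>t^*_v$ such that $\tau$ is a moment at which, in the moat growing with $t^*_v$ replaced by $\infty$, the active set containing $v$ merges with another active set. The local search on $(G,t,\beta)$ starts with $t^*=t$ and applies, in any order, valuable boost actions of this kind until none is left. Its *final execution* is boosted moat growing on $(t,t^*)$ with the resulting $t^*$. **Assignments.** In an execution, a vertex is active at a moment if it has been in active sets from the beginning up to that moment. A set of vertices is *actively connected* if its members stay in active sets from the beginning until all of them lie in the same connected component. An *assignment* is a function $r:2^V\times V\to\mathbb R_{\ge0}$ with $r_{A,v}\le y_A$ (the final value of $y_A$), and with $r_{A,v}>0$ only if $v\in A$ and $v$ is active at the moment at which the active set $A$ is formed; the sum $\sum_v r_{A,v}$ is not bounded by $y_A$. Put $r_v=\sum_{A\subseteq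 V}r_{A,v}$ and $r_{\max}(S)=\max_{v\in S}r_v$. Vertices with larger $t^-_v$ have higher priority; ties are broken by a fixed total order of $V$ in which no vertex lies strictly between a vertex and its pair. The assignment $r$ is *priority-based on $S$* if, whenever $v\in S$ and $r_{A,v}>0$, $v$ is the vertex of highest priority in $S\cap A$. **Lemma.** Consider the final execution of a local search on $(G,t,\beta)$. Let $S\subseteq V$ be a nonempty set of vertices that lies in a single connected component of $\mathrm{OPT}$ and is actively connected in this execution, and let $r$ be any assignment for this execution that is priority-based on $S$. Then $$\frac{6}{5+\beta}\Bigl(\sum_{v\in S}r_v-r_{\max}(S)\Bigr)\le c(T_S),$$ where $T_S$ is the minimal subtree of $\mathrm{OPT}$ containing all vertices of $S$ and $c(T_S)$ is the total cost of its edges. -/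

import Mathlib

/-!
Moat growing algorithms for the Steiner Forest problem, and the local search over their
fingerprints.  A moat growing process is determined by the instance and by the rule that
says which connected components are active at a given moment.  The process is run in the usual
discrete steps: from one event to the next one.
-/

/-- A Steiner Forest instance: a graph with nonnegative edge costs, and an involution that tells
to which vertex each vertex has to be connected (vertices without a demand are their own pair). -/
structure SteinerForest (V : Type*) where
  graph : SimpleGraph V
  cost : Sym2 V → ℝ
  cost_nonneg : ∀ e ∈ graph.edgeSet, 0 ≤ cost e
  pair : V → V
  pair_involutive : Function.Involutive pair

/-- The situation right after all events of the moment `time` have been processed: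
`growth S` is the growth duration `y_S` of the vertex set `S` so far. -/
structure MoatState (V : Type*) where
  time : ℝ
  growth : Finset V → ℝ

/-- What distinguishes one moat growing process from another: `active τ S` says that a connected
component `S` is active at the moment `τ`; `alarms` are the moments, besides those at which an edge
becomes fully coloured, at which a discrete step has to end. -/
structure MoatRule (V : Type*) where
  active : ℝ → Finset V → Prop
  alarms : Finset ℝ

namespace SteinerForest

noncomputable section

open scoped Classical

variable {V : Type*} [Fintype V] (I : SteinerForest V)

/-! ### Solutions and the optimal solution -/

/-- The total cost of a set of edges. -/
def edgeCost (A : Set (Sym2 V)) : ℝ := ∑ e : Sym2 V with e ∈ A, I.cost e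

/-- A subgraph that connects every vertex with its pair. -/
def IsSolution (F : SimpleGraph V) : Prop :=
  F ≤ I.graph ∧ ∀ v, F.Reachable v (I.pair v)

/-- A solution of minimum cost that has the fewest edges among the solutions of minimum cost.
(Costs being nonnegative, it is a forest.) -/
def IsOPT (F : SimpleGraph V) : Prop :=
  I.IsSolution F ∧
    (∀ F', I.IsSolution F' → I.edgeCost F.edgeSet ≤ I.edgeCost F'.edgeSet) ∧
    ∀ F', I.IsSolution F' → I.edgeCost F'.edgeSet = I.edgeCost F.edgeSet →
      F.edgeSet.ncard ≤ F'.edgeSet.ncard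

/-- `T` is the (inclusion-wise) minimal subtree of `F` that contains all vertices of `S`. -/
def IsMinimalSubtree (F : SimpleGraph V) (S : Finset V) (T : F.Subgraph) : Prop :=
  Minimal (fun T' : F.Subgraph => (S : Set V) ⊆ T'.verts ∧ T'.coe.IsTree) T

/-! ### Moat growing -/

/-- `e ∈ δ(S)`: exactly one endpoint of `e` lies in `S`. -/
def Cuts (S : Finset V) (e : Sym2 V) : Prop := ∃ u ∈ S, ∃ v ∉ S, e = s(u, v)

/-- The length of the coloured portion of the edge `e`. -/
def coloured (s : MoatState V) (e : Sym2 V) : ℝ :=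
  ∑ S : Finset V with Cuts S e, s.growth S

/-- The graph of all fully coloured edges.  The forest that the algorithm maintains is a spanning
forest of this graph, so both have the same connected components.  (The coloured portion of an edge
never exceeds its cost.) -/
def fullyColoured (s : MoatState V) : SimpleGraph V where
  Adj u v := I.graph.Adj u v ∧ I.cost s(u, v) ≤ coloured s s(u, v)
  symm := ⟨fun u v h => ⟨h.1.symm, by rw [Sym2.eq_swap]; exact h.2⟩⟩
  loopless := ⟨fun u h => I.graph.loopless.irrefl u h.1⟩

/-- The current connected component of the vertex `v`. -/
def component (s : MoatState V) (v : V) : Finset V :=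
  Finset.univ.filter fun w => (I.fullyColoured s).Reachable v w

/-- The family of the current connected components. -/
def components (s : MoatState V) : Finset (Finset V) := Finset.univ.image (I.component s)

/-- The family of the currently active sets. -/
def activeSets (R : MoatRule V) (s : MoatState V) : Finset (Finset V) :=
  (I.components s).filter (R.active s.time)

/-- How many of the components of the two endpoints `p.1`, `p.2` are active. -/
def activeEnds (R : MoatRule V) (s : MoatState V) (p : V × V) : ℕ :=
  (({I.component s p.1, I.component s p.2} : Finset (Finset V)) ∩ I.activeSets R s).card

/-- The edges between two different components, at least one of which is active. -/
def growingEdges (R : MoatRule V) (s : MoatState V) : Finset (V × V) :=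
  Finset.univ.filter fun p => I.graph.Adj p.1 p.2 ∧
    I.component s p.1 ≠ I.component s p.2 ∧ I.activeEnds R s p ≠ 0

/-- The durations until the possible next events: an edge between different components becomes
fully coloured, or an alarm goes off. -/
def waits (R : MoatRule V) (s : MoatState V) : Finset ℝ :=
  ((I.growingEdges R s).image fun p =>
      (I.cost s(p.1, p.2) - coloured s s(p.1, p.2)) / (I.activeEnds R s p : ℝ)) ∪
    (R.alarms.filter fun a => s.time < a).image fun a => a - s.time

/-- The process goes on: there is an active set, and there is a next event. -/
def Running (R : MoatRule V) (s : MoatState V) : Prop :=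
  (I.activeSets R s).Nonempty ∧ (I.waits R s).Nonempty

/-- One step of the process: all active sets grow until the next event. -/
def next (R : MoatRule V) (s : MoatState V) : MoatState V :=
  if h : I.Running R s then
    { time := s.time + (I.waits R s).min' h.2
      growth := fun S =>
        s.growth S + if S ∈ I.activeSets R s then (I.waits R s).min' h.2 else 0 }
  else s

/-- The state after `n` steps. -/
def stage (R : MoatRule V) (n : ℕ) : MoatState V :=
  (I.next R)^[n] { time := 0, growth := fun _ => 0 }

/-! Every moat growing process comes to an end. -/

theorem component_eq_iff (s : MoatState V) (u v : V) :
    I.component s u = I.component s v ↔ (I.fullyColoured s).Reachable u v := by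
  constructor
  · intro h
    have : v ∈ I.component s v := by simp [component]
    rw [← h] at this
    simpa [component] using this
  · intro h
    ext w
    simp only [component, Finset.mem_filter, Finset.mem_univ, true_and]
    exact ⟨fun h' => h.symm.trans h', fun h' => h.trans h'⟩

theorem waits_pos (R : MoatRule V) (s : MoatState V) {d : ℝ} (hd : d ∈ I.waits R s) : 0 < d := by
  rcases Finset.mem_union.1 hd with hd | hd
  · obtain ⟨p, hp, rfl⟩ := Finset.mem_image.1 hd
    simp only [growingEdges, Finset.mem_filter, Finset.mem_univ, true_and] at hp
    obtain ⟨hadj, hne, hact⟩ := hp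
    have hlt : coloured s s(p.1, p.2) < I.cost s(p.1, p.2) := by
      by_contra hcon
      apply hne
      rw [component_eq_iff]
      exact SimpleGraph.Adj.reachable ⟨hadj, not_lt.1 hcon⟩
    have : (0 : ℝ) < (I.activeEnds R s p : ℝ) := by exact_mod_cast Nat.pos_of_ne_zero hact
    exact div_pos (sub_pos.2 hlt) this
  · obtain ⟨a, ha, rfl⟩ := Finset.mem_image.1 hd
    exact sub_pos.2 (Finset.mem_filter.1 ha).2

theorem growth_le_next (R : MoatRule V) (s : MoatState V) (S : Finset V) :
    s.growth S ≤ (I.next R s).growth S := by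
  unfold next
  split_ifs with h
  · have := I.waits_pos R s (Finset.min'_mem _ h.2)
    dsimp only
    split_ifs <;> linarith
  · exact le_rfl

theorem fullyColoured_le_next (R : MoatRule V) (s : MoatState V) :
    I.fullyColoured s ≤ I.fullyColoured (I.next R s) := by
  intro u v h
  exact ⟨h.1, h.2.trans (Finset.sum_le_sum fun S _ => I.growth_le_next R s S)⟩

theorem components_next (R : MoatRule V) (s : MoatState V) :
    I.components (I.next R s) = (I.components s).image fun C =>
      Finset.univ.filter fun w => ∃ x ∈ C, (I.fullyColoured (I.next R s)).Reachable x w := by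
  unfold components
  rw [Finset.image_image]
  congr 1
  funext v
  ext w
  simp only [component, Function.comp, Finset.mem_filter, Finset.mem_univ, true_and]
  constructor
  · intro h
    exact ⟨v, SimpleGraph.Reachable.refl v, h⟩
  · rintro ⟨x, hx, h⟩
    exact (hx.mono (I.fullyColoured_le_next R s)).trans h

theorem card_components_next_le (R : MoatRule V) (s : MoatState V) :
    (I.components (I.next R s)).card ≤ (I.components s).card := by
  rw [components_next]
  exact Finset.card_image_le

theorem card_components_next_lt (R : MoatRule V) (s : MoatState V) {u v : V}
    (hne : I.component s u ≠ I.component s v)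
    (heq : (I.fullyColoured (I.next R s)).Reachable u v) :
    (I.components (I.next R s)).card < (I.components s).card := by
  refine lt_of_le_of_ne (I.card_components_next_le R s) fun hcard => hne ?_
  rw [components_next] at hcard
  refine Finset.card_image_iff.1 hcard (Finset.mem_coe.2 (Finset.mem_image_of_mem _ (by simp)))
    (Finset.mem_coe.2 (Finset.mem_image_of_mem _ (by simp))) ?_
  ext w
  simp only [component, Finset.mem_filter, Finset.mem_univ, true_and]
  constructor
  · rintro ⟨x, hx, h⟩
    exact ⟨v, SimpleGraph.Reachable.refl v,
      heq.symm.trans ((hx.mono (I.fullyColoured_le_next R s)).trans h)⟩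
  · rintro ⟨x, hx, h⟩
    exact ⟨u, SimpleGraph.Reachable.refl u,
      heq.trans ((hx.mono (I.fullyColoured_le_next R s)).trans h)⟩

theorem measure_next_lt (R : MoatRule V) (s : MoatState V) (h : I.Running R s) :
    (I.components (I.next R s)).card + (R.alarms.filter fun a => (I.next R s).time < a).card <
      (I.components s).card + (R.alarms.filter fun a => s.time < a).card := by
  have hmem := Finset.min'_mem _ h.2
  have hpos := I.waits_pos R s hmem
  have htime : (I.next R s).time = s.time + (I.waits R s).min' h.2 := by
    unfold next; rw [dif_pos h]
  have hsub : (R.alarms.filter fun a => (I.next R s).time < a) ⊆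
      R.alarms.filter fun a => s.time < a := by
    intro a ha
    simp only [Finset.mem_filter] at ha ⊢
    exact ⟨ha.1, by linarith [ha.2]⟩
  rcases Finset.mem_union.1 hmem with hm | hm
  · obtain ⟨p, hp, hpd⟩ := Finset.mem_image.1 hm
    simp only [growingEdges, Finset.mem_filter, Finset.mem_univ, true_and] at hp
    obtain ⟨hadj, hne, hact⟩ := hp
    have hk : (0 : ℝ) < (I.activeEnds R s p : ℝ) := by exact_mod_cast Nat.pos_of_ne_zero hact
    rw [div_eq_iff hk.ne'] at hpd
    refine Nat.add_lt_add_of_lt_of_le ?_ (Finset.card_le_card hsub)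
    refine I.card_components_next_lt R s hne (SimpleGraph.Adj.reachable ⟨hadj, ?_⟩)
    have hgrow : ∀ S, (I.next R s).growth S =
        s.growth S + if S ∈ I.activeSets R s then (I.waits R s).min' h.2 else 0 := by
      intro S; unfold next; rw [dif_pos h]
    have hcut : ({I.component s p.1, I.component s p.2} : Finset (Finset V)) ∩ I.activeSets R s ⊆
        (Finset.univ.filter fun S : Finset V => Cuts S s(p.1, p.2)).filter
          (· ∈ I.activeSets R s) := by
      intro S hS
      simp only [Finset.mem_inter, Finset.mem_insert, Finset.mem_singleton] at hS
      simp only [Finset.mem_filter, Finset.mem_univ, true_and]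
      refine ⟨?_, hS.2⟩
      have hnr : ¬ (I.fullyColoured s).Reachable p.1 p.2 := fun hr =>
        hne ((I.component_eq_iff s _ _).2 hr)
      rcases hS.1 with rfl | rfl
      · exact ⟨p.1, by simp [component], p.2, by simpa [component] using hnr, rfl⟩
      · exact ⟨p.2, by simp [component], p.1,
          by simpa [component] using fun hr => hnr (SimpleGraph.Reachable.symm hr),
          Sym2.eq_swap⟩
    have hcard := Finset.card_le_card hcut
    have hsum : coloured (I.next R s) s(p.1, p.2) = coloured s s(p.1, p.2) +
        (((Finset.univ.filter fun S : Finset V => Cuts S s(p.1, p.2)).filter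
          (· ∈ I.activeSets R s)).card : ℝ) * (I.waits R s).min' h.2 := by
      unfold coloured
      simp only [hgrow, Finset.sum_add_distrib]
      rw [← Finset.sum_filter, Finset.sum_const, nsmul_eq_mul]
    have hcard' : (I.activeEnds R s p : ℝ) ≤
        (((Finset.univ.filter fun S : Finset V => Cuts S s(p.1, p.2)).filter
          (· ∈ I.activeSets R s)).card : ℝ) := by exact_mod_cast hcard
    have := mul_le_mul_of_nonneg_right hcard' hpos.le
    rw [hsum]
    linarith
  · obtain ⟨a, ha, had⟩ := Finset.mem_image.1 hm
    refine Nat.add_lt_add_of_le_of_lt (I.card_components_next_le R s) (Finset.card_lt_card ?_)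
    refine Finset.ssubset_iff_subset_ne.2 ⟨hsub, fun heq => ?_⟩
    rw [← heq, Finset.mem_filter] at ha
    linarith [ha.2]

theorem exists_not_running (R : MoatRule V) : ∃ n, ¬ I.Running R (I.stage R n) := by
  by_contra hcon
  push Not at hcon
  have key : ∀ n, (I.components (I.stage R n)).card +
      (R.alarms.filter fun a => (I.stage R n).time < a).card + n ≤
      (I.components (I.stage R 0)).card +
      (R.alarms.filter fun a => (I.stage R 0).time < a).card := by
    intro n
    induction n with
    | zero => simp
    | succ n ih =>
      have h := I.measure_next_lt R _ (hcon n)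
      have hs : I.stage R (n + 1) = I.next R (I.stage R n) := by
        unfold stage; rw [Function.iterate_succ_apply']
      rw [hs]
      omega
  have := key ((I.components (I.stage R 0)).card +
      (R.alarms.filter fun a => (I.stage R 0).time < a).card + 1)
  omega

/-- The number of steps until the process ends. -/
def lastStage (R : MoatRule V) : ℕ := Nat.find (I.exists_not_running R)

/-- `y_S`: the growth duration of `S` during the whole process. -/
def finalGrowth (R : MoatRule V) (S : Finset V) : ℝ := (I.stage R (I.lastStage R)).growth S

/-- The vertex `v` is active up to (and including) stage `n`: it has been in active sets from the
beginning. -/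
def ActiveUpTo (R : MoatRule V) (n : ℕ) (v : V) : Prop :=
  ∀ m ≤ n, I.component (I.stage R m) v ∈ I.activeSets R (I.stage R m)

/-- The vertices of `S` are connected while active: there is a stage at which all of them lie in
the same connected component, and up to then all of them have been in active sets. -/
def ActivelyConnected (R : MoatRule V) (S : Finset V) : Prop :=
  ∃ n, (∀ u ∈ S, ∀ v ∈ S, I.component (I.stage R n) u = I.component (I.stage R n) v) ∧
    ∀ m < n, ∀ v ∈ S, I.component (I.stage R m) v ∈ I.activeSets R (I.stage R m)

/-- `v` belongs to the superactive set of the active set `S`. -/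
def InSuperactive (R : MoatRule V) (S : Finset V) (v : V) : Prop :=
  v ∈ S ∧ ∃ n, S ∈ I.activeSets R (I.stage R n) ∧
    (∀ m < n, S ∉ I.activeSets R (I.stage R m)) ∧ I.ActiveUpTo R n v

/-! ### Legacy moat growing and priorities -/

/-- In legacy moat growing a component is active as long as it contains a vertex whose pair lies
outside of it. -/
def legacyRule : MoatRule V where
  active _ S := ∃ v ∈ S, I.pair v ∉ S
  alarms := ∅

/-- The first moment at which `v` and its pair are connected in legacy moat growing. -/
def legacyTime (v : V) : ℝ :=
  sInf {τ | ∃ n, (I.stage I.legacyRule n).time = τ ∧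
    I.pair v ∈ I.component (I.stage I.legacyRule n) v}

/-- A total order of the vertices (given by ranks) that comes from ordering the demand pairs, and
then the two vertices within each pair: no vertex lies strictly between a vertex and its pair. -/
def IsTieBreaker (rank : V → ℕ) : Prop :=
  Function.Injective rank ∧ ∀ u w, ¬ (rank u < rank w ∧ rank w < rank (I.pair u))

/-- The priority of `u` is lower than the priority of `v`. -/
def PriorityLT (rank : V → ℕ) (u v : V) : Prop :=
  I.legacyTime u < I.legacyTime v ∨ (I.legacyTime u = I.legacyTime v ∧ rank u < rank v)

/-! ### Boosted moat growing and the local search -/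

/-- Boosted moat growing with base fingerprint `t` and boosted fingerprint `b`: a component is
active as long as it contains a vertex `v` with `b v > τ`. -/
def boostedRule (t b : V → ℝ) : MoatRule V where
  active τ S := ∃ v ∈ S, τ < b v
  alarms := Finset.univ.image t ∪ Finset.univ.image b

/-- `y_base`: the total growth of active sets at moments `τ` at which they contain a vertex `v` with
`t v > τ`. -/
def yBase (t b : V → ℝ) : ℝ :=
  ∑ n ∈ Finset.range (I.lastStage (boostedRule t b)),
    ∑ S ∈ I.activeSets (boostedRule t b) (I.stage (boostedRule t b) n)
      with ∃ v ∈ S, (I.stage (boostedRule t b) n).time < t v,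
      ((I.stage (boostedRule t b) (n + 1)).time - (I.stage (boostedRule t b) n).time)

/-- `y_boost`: the total growth of active sets at all other moments. -/
def yBoost (t b : V → ℝ) : ℝ :=
  ∑ n ∈ Finset.range (I.lastStage (boostedRule t b)),
    ∑ S ∈ I.activeSets (boostedRule t b) (I.stage (boostedRule t b) n)
      with ¬ ∃ v ∈ S, (I.stage (boostedRule t b) n).time < t v,
      ((I.stage (boostedRule t b) (n + 1)).time - (I.stage (boostedRule t b) n).time)

/-- The win of the boost action `(v, τ)`. -/
def win (t b : V → ℝ) (v : V) (τ : ℝ) : ℝ :=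
  I.yBase t b - I.yBase t (Function.update b v τ)

/-- The loss of the boost action `(v, τ)`. -/
def loss (t b : V → ℝ) (v : V) (τ : ℝ) : ℝ :=
  I.yBoost t (Function.update b v τ) - I.yBoost t b

/-- The boost action `(v, τ)` is valuable. -/
def Valuable (β : ℝ) (t b : V → ℝ) (v : V) (τ : ℝ) : Prop :=
  (1 + β) * I.loss t b v τ ≤ I.win t b v τ

/-- Moat growing with the fingerprint `b`, except that the fingerprint of `v` is infinite. -/
def foreverRule (b : V → ℝ) (v : V) : MoatRule V where
  active τ S := v ∈ S ∨ ∃ u ∈ S, τ < b u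
  alarms := Finset.univ.image b

/-- The boost action space: `τ > b v` is a moment at which, if the fingerprint of `v` were infinite,
the active set containing `v` would merge with another active set. -/
def IsBoostCandidate (b : V → ℝ) (v : V) (τ : ℝ) : Prop :=
  b v < τ ∧ ∃ n, (I.stage (foreverRule b v) (n + 1)).time = τ ∧
    ∃ D ∈ I.activeSets (foreverRule b v) (I.stage (foreverRule b v) n),
      D ≠ I.component (I.stage (foreverRule b v) n) v ∧
      D ⊆ I.component (I.stage (foreverRule b v) (n + 1)) v

/-- The boosted fingerprints that the local search on `(G, t, β)` may produce, by applying
valuable boost actions one after the other. -/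
inductive LocalSearchReaches (β : ℝ) (t : V → ℝ) : (V → ℝ) → Prop
  | start : LocalSearchReaches β t t
  | boost {b : V → ℝ} {v : V} {τ : ℝ} : LocalSearchReaches β t b → I.IsBoostCandidate b v τ →
      I.Valuable β t b v τ → LocalSearchReaches β t (Function.update b v τ)

/-- `b` is the boosted fingerprint with which a run of the local search ends: no valuable boost
action is left. -/
def IsLocalSearchOutput (β : ℝ) (t b : V → ℝ) : Prop :=
  I.LocalSearchReaches β t b ∧ ∀ v τ, I.IsBoostCandidate b v τ → ¬ I.Valuable β t b v τ

/-! ### Assignments -/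

/-- `r S v` is the portion of the growth of the set `S` that is assigned to the vertex `v`; growth
is assigned to vertices of the superactive set only.  There is no bound on the sum over `v`. -/
def IsAssignment (R : MoatRule V) (r : Finset V → V → ℝ) : Prop :=
  ∀ S v, 0 ≤ r S v ∧ r S v ≤ I.finalGrowth R S ∧ (0 < r S v → I.InSuperactive R S v)

/-- `r_v`: the total growth assigned to `v`. -/
def assigned (r : Finset V → V → ℝ) (v : V) : ℝ := ∑ S : Finset V, r S v

/-- The assignment `r` is priority-based on `S`: whenever growth of a set `A` is assigned to a
vertex `v` of `S`, then `v` is the vertex of highest priority in `S ∩ A`. -/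
def IsPriorityBased (rank : V → ℕ) (r : Finset V → V → ℝ) (S : Finset V) : Prop :=
  ∀ A, ∀ v ∈ S, 0 < r A v → v ∈ A ∧ ∀ u ∈ S, u ∈ A → u ≠ v → I.PriorityLT rank u v

end

end SteinerForest

/-! Let H be the moment at which `S` is connected, and let J(X) be the integral over the times up to
H of the number of current components that meet X, minus one (`excess`). By the priority rule, each
component gives growth to at most one vertex of `S`, and a component containing the top vertex of
`S` gives it to no other vertex of `S`. So the sum of the `r_v` minus the largest one is at most
J(S) (`sum_assigned_sub_sup_le`). It remains to show 6 J(S) ≤ (5 + β) c(T) (`six_mul_le_edgeCost`).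

Local optimality enters through stars with three leaves (`two_mul_excess_star_le`): if v has walks
of cost at most a₁ ≤ a₂, a₃ to q₁, q₂, q₃ in `S`, then 2 J({q₁, q₂, q₃}) ≤ a₁ + a₂ + a₃ + β a₁. A
boost is valuable exactly if it does not increase y_base + (1 + β) y_boost, which is the time
integral of a weighted number of active sets (`potential`). Vertices that stay active and have
distance a meet by time a/2 (`two_mul_le_of_not_conn`). Hence a suitably boosted v is an additional
active set, of weight at most 1 + β, only up to time a₁/2. Afterwards it glues together the
components of the terminals it has reached and saves at least 1 for each of them but one. Without a
valuable boost, the savings cannot outweigh the costs, and this is the star bound. The runs are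
compared at equal moments, using that larger fingerprints give coarser components
(`HasFingerprint.conn_mono`).

For the tree, J is subadditive on sets sharing a vertex. Where two branches X = X₁ ∪ X₂ and Y = Y₁ ∪
Y₂ meet, their union can be connected in two ways: a star links X₁, X₂ and Y, or a star links Y₁, Y₂
and X. Adding the two estimates shows that the inequality in `SplitsAt` survives the join
(`SplitsAt.join`). At the end one path links the last two parts, which turns the invariant into the
factor 6. -/

open MeasureTheory

namespace SteinerForest

noncomputable section

open scoped Classical

variable {V : Type*} [Fintype V] (I : SteinerForest V) (R : MoatRule V)

/-! ### The discrete run of a moat growing process -/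

/-- The moment of the `n`-th stage. -/
def moment (n : ℕ) : ℝ := (I.stage R n).time

/-- `u` and `w` are connected at stage `n`. -/
def Conn (n : ℕ) (u w : V) : Prop := (I.fullyColoured (I.stage R n)).Reachable u w

/-- The component of `u` is active at stage `n`. -/
def Act (n : ℕ) (u : V) : Prop :=
  I.component (I.stage R n) u ∈ I.activeSets R (I.stage R n)

/-- The rate at which the edge `uw` gets coloured during stage `n`. -/
def rate (n : ℕ) (u w : V) : ℝ :=
  if I.Conn R n u w then 0 else (if I.Act R n u then 1 else 0) + if I.Act R n w then 1 else 0

theorem stage_succ (n : ℕ) : I.stage R (n + 1) = I.next R (I.stage R n) := by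
  unfold stage; rw [Function.iterate_succ_apply']

theorem running_of_lt {n : ℕ} (h : n < I.lastStage R) : I.Running R (I.stage R n) :=
  not_not.1 (Nat.find_min (I.exists_not_running R) h)

theorem not_running_lastStage : ¬ I.Running R (I.stage R (I.lastStage R)) :=
  Nat.find_spec (I.exists_not_running R)

theorem stage_of_le {n : ℕ} (h : I.lastStage R ≤ n) :
    I.stage R n = I.stage R (I.lastStage R) := by
  induction n, h using Nat.le_induction with
  | base => rfl
  | succ n _ ih =>
    rw [stage_succ, ih, next, dif_neg (I.not_running_lastStage R)]

theorem lt_lastStage_of_running {n : ℕ} (h : I.Running R (I.stage R n)) : n < I.lastStage R := by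
  by_contra hn
  rw [I.stage_of_le R (not_lt.1 hn)] at h
  exact I.not_running_lastStage R h

@[simp] theorem moment_zero : I.moment R 0 = 0 := rfl

theorem moment_succ {n : ℕ} (h : I.Running R (I.stage R n)) :
    I.moment R (n + 1) = I.moment R n + (I.waits R (I.stage R n)).min' h.2 := by
  unfold moment
  rw [stage_succ, next, dif_pos h]

theorem moment_lt_succ {n : ℕ} (h : n < I.lastStage R) : I.moment R n < I.moment R (n + 1) := by
  have hr := I.running_of_lt R h
  rw [I.moment_succ R hr]
  linarith [I.waits_pos R _ (Finset.min'_mem _ hr.2)]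

theorem moment_le_succ (n : ℕ) : I.moment R n ≤ I.moment R (n + 1) := by
  by_cases h : n < I.lastStage R
  · exact (I.moment_lt_succ R h).le
  · unfold moment
    rw [I.stage_of_le R (not_lt.1 h), I.stage_of_le R (le_trans (not_lt.1 h) n.le_succ)]

theorem moment_mono : Monotone (I.moment R) := monotone_nat_of_le_succ (I.moment_le_succ R)

theorem moment_nonneg (n : ℕ) : 0 ≤ I.moment R n := by
  simpa using I.moment_mono R (Nat.zero_le n)

theorem growth_succ (n : ℕ) (A : Finset V) :
    (I.stage R (n + 1)).growth A = (I.stage R n).growth A +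
      if A ∈ I.activeSets R (I.stage R n) then I.moment R (n + 1) - I.moment R n else 0 := by
  by_cases h : I.Running R (I.stage R n)
  · rw [I.moment_succ R h, stage_succ, next, dif_pos h]
    simp
  · have : I.moment R (n + 1) = I.moment R n := by
      unfold moment; rw [stage_succ, next, dif_neg h]
    rw [this, stage_succ, next, dif_neg h]
    simp

theorem growth_eq_sum (n : ℕ) (A : Finset V) :
    (I.stage R n).growth A = ∑ k ∈ Finset.range n, (I.moment R (k + 1) - I.moment R k) *
      if A ∈ I.activeSets R (I.stage R k) then 1 else 0 := by
  induction n with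
  | zero => simp [stage]
  | succ n ih => rw [growth_succ, ih, Finset.sum_range_succ]; simp

variable {I R}

theorem Conn.refl (n : ℕ) (u : V) : I.Conn R n u u := SimpleGraph.Reachable.refl u

theorem Conn.symm {n : ℕ} {u w : V} (h : I.Conn R n u w) : I.Conn R n w u :=
  SimpleGraph.Reachable.symm h

theorem Conn.trans {n : ℕ} {u w z : V} (h : I.Conn R n u w) (h' : I.Conn R n w z) :
    I.Conn R n u z := SimpleGraph.Reachable.trans h h'

theorem Conn.mono {n m : ℕ} (hnm : n ≤ m) {u w : V} (h : I.Conn R n u w) : I.Conn R m u w := by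
  induction m, hnm using Nat.le_induction with
  | base => exact h
  | succ m _ ih =>
    unfold Conn
    rw [stage_succ]
    exact SimpleGraph.Reachable.mono (I.fullyColoured_le_next R _) ih

theorem component_eq_iff_conn {n : ℕ} {u w : V} :
    I.component (I.stage R n) u = I.component (I.stage R n) w ↔ I.Conn R n u w :=
  I.component_eq_iff _ _ _

theorem mem_component_iff {n : ℕ} {u w : V} :
    w ∈ I.component (I.stage R n) u ↔ I.Conn R n u w := by simp [component, Conn]

theorem mem_activeSets_iff {n : ℕ} {A : Finset V} : A ∈ I.activeSets R (I.stage R n) ↔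
    (∃ u, I.component (I.stage R n) u = A) ∧ R.active (I.moment R n) A := by
  simp [activeSets, components, moment]

theorem act_iff {n : ℕ} {u : V} :
    I.Act R n u ↔ R.active (I.moment R n) (I.component (I.stage R n) u) := by
  simp [Act, mem_activeSets_iff]

theorem Act.congr {n : ℕ} {u w : V} (h : I.Conn R n u w) : I.Act R n u ↔ I.Act R n w := by
  unfold Act; rw [component_eq_iff_conn.2 h]

theorem component_of_mem_activeSets {n : ℕ} {A : Finset V}
    (hA : A ∈ I.activeSets R (I.stage R n)) {u : V} (hu : u ∈ A) :
    I.component (I.stage R n) u = A := by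
  obtain ⟨⟨w, rfl⟩, -⟩ := mem_activeSets_iff.1 hA
  exact (component_eq_iff_conn.2 (mem_component_iff.1 hu)).symm

theorem rate_nonneg (n : ℕ) (u w : V) : 0 ≤ I.rate R n u w := by
  unfold rate; split_ifs <;> norm_num

variable (I R)

/-- Components are disjoint, so the only active sets cut by the edge are the components of its two
endpoints. -/
theorem sum_active_cuts (n : ℕ) (u w : V) :
    (∑ A : Finset V with Cuts A s(u, w),
      if A ∈ I.activeSets R (I.stage R n) then (1 : ℝ) else 0) = I.rate R n u w := by
  rw [← Finset.sum_filter, Finset.sum_const, nsmul_eq_mul, mul_one, Finset.filter_filter]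
  by_cases hc : I.Conn R n u w
  · rw [rate, if_pos hc, Nat.cast_eq_zero, Finset.card_eq_zero, Finset.filter_eq_empty_iff]
    rintro A - ⟨⟨x, hx, y, hy, he⟩, hA⟩
    have key : I.Conn R n x y := by
      rcases Sym2.eq_iff.1 he with ⟨rfl, rfl⟩ | ⟨rfl, rfl⟩
      · exact hc
      · exact hc.symm
    have := component_of_mem_activeSets hA hx
    rw [← this] at hy
    exact hy (mem_component_iff.2 key)
  · have hne : I.component (I.stage R n) u ≠ I.component (I.stage R n) w :=
      fun h => hc (component_eq_iff_conn.1 h)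
    have : (Finset.univ.filter fun A : Finset V =>
        Cuts A s(u, w) ∧ A ∈ I.activeSets R (I.stage R n)) =
        ({I.component (I.stage R n) u, I.component (I.stage R n) w} : Finset (Finset V)).filter
          (· ∈ I.activeSets R (I.stage R n)) := by
      ext A
      simp only [Finset.mem_filter, Finset.mem_univ, true_and, Finset.mem_insert,
        Finset.mem_singleton, and_congr_left_iff]
      intro hA
      constructor
      · rintro ⟨x, hx, y, hy, he⟩
        rw [← component_of_mem_activeSets hA hx]
        rcases Sym2.eq_iff.1 he with ⟨rfl, rfl⟩ | ⟨rfl, rfl⟩ <;> simp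
      · rintro (rfl | rfl)
        · exact ⟨u, mem_component_iff.2 (Conn.refl _ _), w,
            fun h => hc (mem_component_iff.1 h), rfl⟩
        · exact ⟨w, mem_component_iff.2 (Conn.refl _ _), u,
            fun h => hc (mem_component_iff.1 h).symm, Sym2.eq_swap⟩
    rw [this, rate, if_neg hc, Finset.filter_insert, Finset.filter_singleton]
    unfold Act
    split_ifs <;> (simp [hne]; try norm_num)

theorem coloured_succ (n : ℕ) (u w : V) :
    coloured (I.stage R (n + 1)) s(u, w) = coloured (I.stage R n) s(u, w) +
      (I.moment R (n + 1) - I.moment R n) * I.rate R n u w := by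
  rw [← sum_active_cuts, coloured, coloured, Finset.mul_sum, ← Finset.sum_add_distrib]
  refine Finset.sum_congr rfl fun A _ => ?_
  rw [growth_succ]
  simp

theorem coloured_eq_sum (n : ℕ) (u w : V) :
    coloured (I.stage R n) s(u, w) =
      ∑ k ∈ Finset.range n, (I.moment R (k + 1) - I.moment R k) * I.rate R k u w := by
  induction n with
  | zero => simp [coloured, stage]
  | succ n ih => rw [coloured_succ, ih, Finset.sum_range_succ]

theorem activeEnds_eq_rate {n : ℕ} {u w : V} (h : ¬ I.Conn R n u w) :
    (I.activeEnds R (I.stage R n) (u, w) : ℝ) = I.rate R n u w := by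
  have hne : I.component (I.stage R n) u ≠ I.component (I.stage R n) w :=
    fun h' => h (component_eq_iff_conn.1 h')
  rw [activeEnds, rate, if_neg h, ← Finset.filter_mem_eq_inter, Finset.filter_insert,
    Finset.filter_singleton]
  unfold Act
  split_ifs <;> (simp [hne]; try norm_num)

/-- The waiting time until the edge is full is a candidate for the next event, so it cannot elapse
within a step. After the last stage no bound on `x` is needed: a positive rate would keep the
process running. -/
theorem coloured_add_lt {n : ℕ} {u w : V} (hadj : I.graph.Adj u w) (h : ¬ I.Conn R n u w)
    {x : ℝ} (hx : n < I.lastStage R → x < I.moment R (n + 1)) :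
    coloured (I.stage R n) s(u, w) + (x - I.moment R n) * I.rate R n u w < I.cost s(u, w) := by
  have hlt : coloured (I.stage R n) s(u, w) < I.cost s(u, w) := by
    by_contra hcon
    exact h (SimpleGraph.Adj.reachable ⟨hadj, not_lt.1 hcon⟩)
  rcases (rate_nonneg (I := I) (R := R) n u w).eq_or_lt with h0 | hpos
  · rw [← h0]; simpa using hlt
  · have hw : (I.cost s(u, w) - coloured (I.stage R n) s(u, w)) / I.rate R n u w ∈
        I.waits R (I.stage R n) := by
      refine Finset.mem_union_left _ (Finset.mem_image.2 ⟨(u, w), ?_, ?_⟩)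
      · simp only [growingEdges, Finset.mem_filter, Finset.mem_univ, true_and]
        refine ⟨hadj, fun h' => h (component_eq_iff_conn.1 h'), fun h0 => ?_⟩
        have := I.activeEnds_eq_rate R h
        rw [h0] at this
        simp [← this] at hpos
      · rw [I.activeEnds_eq_rate R h]
    have hact : (I.activeSets R (I.stage R n)).Nonempty := by
      rw [rate, if_neg h] at hpos
      by_contra hcon
      rw [Finset.not_nonempty_iff_eq_empty] at hcon
      simp [Act, hcon] at hpos
    have hrun : I.Running R (I.stage R n) := ⟨hact, ⟨_, hw⟩⟩
    have h1 := hx (I.lt_lastStage_of_running R hrun)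
    rw [I.moment_succ R hrun] at h1
    have h2 := Finset.min'_le _ _ hw
    have h3 : x - I.moment R n < (I.cost s(u, w) - coloured (I.stage R n) s(u, w)) /
      I.rate R n u w := by linarith
    rw [lt_div_iff₀ hpos] at h3
    linarith

theorem coloured_le_cost {u w : V} (hadj : I.graph.Adj u w) {n : ℕ} (hn : n ≤ I.lastStage R) :
    coloured (I.stage R n) s(u, w) ≤ I.cost s(u, w) := by
  induction n with
  | zero => simpa [coloured, stage] using I.cost_nonneg _ hadj
  | succ n ih =>
    by_cases hc : I.Conn R n u w
    · rw [coloured_succ, rate, if_pos hc]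
      simpa using ih (by omega)
    · rw [coloured_succ]
      -- The strict inequality inside the step passes to the limit at its right end, the moment at
      -- which the edge may become full.
      have hlim : ∀ᶠ x in nhdsWithin (I.moment R (n + 1)) (Set.Iio (I.moment R (n + 1))),
          coloured (I.stage R n) s(u, w) + (x - I.moment R n) * I.rate R n u w ≤
            I.cost s(u, w) := by
        filter_upwards [self_mem_nhdsWithin] with x hx
        exact (I.coloured_add_lt R hadj hc fun _ => hx).le
      have hcont : Continuous fun x : ℝ => coloured (I.stage R n) s(u, w) +
          (x - I.moment R n) * I.rate R n u w := by fun_prop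
      exact le_of_tendsto (hcont.continuousWithinAt (s := Set.Iio (I.moment R (n + 1)))
        (x := I.moment R (n + 1))) hlim

/-! ### The run in real time -/

/-- The stage that is current at the moment `x`. -/
def stageAt (x : ℝ) : ℕ := Nat.findGreatest (fun n => I.moment R n ≤ x) (I.lastStage R)

theorem stageAt_le (x : ℝ) : I.stageAt R x ≤ I.lastStage R := Nat.findGreatest_le _

theorem stageAt_mono : Monotone (I.stageAt R) := fun _ _ h =>
  Nat.findGreatest_mono (fun _ hn => hn.trans h) le_rfl

theorem moment_stageAt_le {x : ℝ} (hx : 0 ≤ x) : I.moment R (I.stageAt R x) ≤ x :=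
  Nat.findGreatest_spec (P := fun n => I.moment R n ≤ x) (Nat.zero_le _) (by simpa using hx)

theorem lt_moment_of_stageAt_lt {x : ℝ} {n : ℕ} (h : I.stageAt R x < n)
    (hn : n ≤ I.lastStage R) : x < I.moment R n :=
  not_le.1 (Nat.findGreatest_is_greatest h hn)

theorem lt_moment_succ_stageAt {x : ℝ} (h : I.stageAt R x < I.lastStage R) :
    x < I.moment R (I.stageAt R x + 1) :=
  I.lt_moment_of_stageAt_lt R (Nat.lt_succ_self _) h

theorem le_stageAt {x : ℝ} {n : ℕ} (hn : n ≤ I.lastStage R) (h : I.moment R n ≤ x) :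
    n ≤ I.stageAt R x := Nat.le_findGreatest hn h

theorem stageAt_moment {n : ℕ} (hn : n ≤ I.lastStage R) : I.stageAt R (I.moment R n) = n := by
  refine le_antisymm ?_ (I.le_stageAt R hn le_rfl)
  by_contra h
  rw [not_le] at h
  have h1 := I.moment_stageAt_le R (I.moment_nonneg R n)
  have h2 := I.moment_lt_succ R (lt_of_lt_of_le h (I.stageAt_le R _))
  have h3 := I.moment_mono R (Nat.succ_le_of_lt h)
  simp only [Nat.succ_eq_add_one] at h3
  linarith

theorem stageAt_lt {x : ℝ} (hx : 0 ≤ x) {n : ℕ} (h : x < I.moment R n) : I.stageAt R x < n := by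
  by_contra hn
  have := (I.moment_mono R (not_lt.1 hn)).trans (I.moment_stageAt_le R hx)
  linarith

theorem intervalIntegrable_stageAt₂ (R' : MoatRule V) (g : ℕ → ℕ → ℝ) (a b : ℝ) :
    IntervalIntegrable (fun y => g (I.stageAt R y) (I.stageAt R' y)) volume a b := by
  have hmeas : Measurable fun y => g (I.stageAt R y) (I.stageAt R' y) :=
    (measurable_of_countable fun p : ℕ × ℕ => g p.1 p.2).comp
      ((I.stageAt_mono R).measurable.prodMk (I.stageAt_mono R').measurable)
  refine (intervalIntegrable_const (c := ∑ i ∈ Finset.range (I.lastStage R + 1),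
    ∑ j ∈ Finset.range (I.lastStage R' + 1), |g i j|)).mono_fun hmeas.aestronglyMeasurable ?_
  refine Filter.Eventually.of_forall fun y => ?_
  simp only [Real.norm_eq_abs]
  refine le_trans ?_ (le_abs_self _)
  refine le_trans ?_ (Finset.single_le_sum (f := fun i => ∑ j ∈ Finset.range (I.lastStage R' + 1),
    |g i j|) (fun i _ => Finset.sum_nonneg fun j _ => abs_nonneg _)
    (Finset.mem_range.2 (Nat.lt_succ_of_le (I.stageAt_le R y))))
  exact Finset.single_le_sum (f := fun j => |g (I.stageAt R y) j|) (fun j _ => abs_nonneg _)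
    (Finset.mem_range.2 (Nat.lt_succ_of_le (I.stageAt_le R' y)))

theorem intervalIntegrable_stageAt (g : ℕ → ℝ) (a b : ℝ) :
    IntervalIntegrable (fun y => g (I.stageAt R y)) volume a b :=
  I.intervalIntegrable_stageAt₂ R R (fun i _ => g i) a b

theorem integral_stageAt_step (g : ℕ → ℝ) {n : ℕ} {x : ℝ} (hnx : I.moment R n ≤ x)
    (hn : n ≤ I.lastStage R) (hx : n < I.lastStage R → x ≤ I.moment R (n + 1)) :
    ∫ y in I.moment R n..x, g (I.stageAt R y) = (x - I.moment R n) * g n := by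
  rw [intervalIntegral.integral_congr_Ioo_of_le (g := fun _ => g n) hnx]
  · simp
  · intro y hy
    have h1 := I.le_stageAt R hn hy.1.le
    have h2 : I.stageAt R y ≤ n := by
      by_cases hl : n < I.lastStage R
      · exact Nat.lt_succ_iff.1
          (I.stageAt_lt R ((I.moment_nonneg R n).trans hy.1.le) (hy.2.trans_le (hx hl)))
      · exact (I.stageAt_le R y).trans (not_lt.1 hl)
    simp only [le_antisymm h2 h1]

theorem integral_stageAt_moment (g : ℕ → ℝ) {n : ℕ} (hn : n ≤ I.lastStage R) :
    ∫ y in (0 : ℝ)..I.moment R n, g (I.stageAt R y) =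
      ∑ k ∈ Finset.range n, (I.moment R (k + 1) - I.moment R k) * g k := by
  induction n with
  | zero => simp
  | succ n ih =>
    rw [← intervalIntegral.integral_add_adjacent_intervals
      (I.intervalIntegrable_stageAt R g 0 (I.moment R n)) (I.intervalIntegrable_stageAt R g _ _),
      ih (by omega), Finset.sum_range_succ, I.integral_stageAt_step R g (I.moment_le_succ R n)
      (by omega) fun _ => le_rfl]

theorem integral_stageAt (g : ℕ → ℝ) {x : ℝ} (hx : 0 ≤ x) :
    ∫ y in (0 : ℝ)..x, g (I.stageAt R y) =
      ∑ k ∈ Finset.range (I.stageAt R x), (I.moment R (k + 1) - I.moment R k) * g k +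
        (x - I.moment R (I.stageAt R x)) * g (I.stageAt R x) := by
  rw [← intervalIntegral.integral_add_adjacent_intervals
    (I.intervalIntegrable_stageAt R g 0 (I.moment R (I.stageAt R x)))
    (I.intervalIntegrable_stageAt R g _ _), I.integral_stageAt_moment R g (I.stageAt_le R x),
    I.integral_stageAt_step R g (I.moment_stageAt_le R hx) (I.stageAt_le R x)
    fun h => (I.lt_moment_succ_stageAt R h).le]

theorem integral_rate_lt {u w : V} (hadj : I.graph.Adj u w) {x : ℝ} (hx : 0 ≤ x)
    (h : ¬ I.Conn R (I.stageAt R x) u w) :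
    ∫ y in (0 : ℝ)..x, I.rate R (I.stageAt R y) u w < I.cost s(u, w) := by
  rw [I.integral_stageAt R (fun k => I.rate R k u w) hx, ← coloured_eq_sum]
  exact I.coloured_add_lt R hadj h (I.lt_moment_succ_stageAt R)

theorem integral_rate_le {u w : V} (hadj : I.graph.Adj u w) {x : ℝ} (hx : 0 ≤ x) :
    ∫ y in (0 : ℝ)..x, I.rate R (I.stageAt R y) u w ≤ I.cost s(u, w) := by
  by_cases h : I.Conn R (I.stageAt R x) u w
  · rw [I.integral_stageAt R (fun k => I.rate R k u w) hx, ← coloured_eq_sum, rate, if_pos h]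
    simpa using I.coloured_le_cost R hadj (I.stageAt_le R x)
  · exact (I.integral_rate_lt R hadj hx h).le

/-! ### Fingerprints -/

/-- Activity in the process is governed by the fingerprint `f`: a component is active as long as
it contains a vertex whose fingerprint has not been reached. -/
structure HasFingerprint (R : MoatRule V) (f : V → EReal) : Prop where
  active_iff : ∀ τ A, R.active τ A ↔ ∃ z ∈ A, (τ : EReal) < f z
  alarm : ∀ z (a : ℝ), f z = a → a ∈ R.alarms

variable {I R} {f : V → EReal}

/-- Alarms end steps: as long as some set is active, an alarm that is ahead at the start of the
current step is still ahead at `x`. -/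
theorem lt_of_mem_alarms {x a : ℝ} (ha : a ∈ R.alarms)
    (hact : (I.activeSets R (I.stage R (I.stageAt R x))).Nonempty)
    (h : I.moment R (I.stageAt R x) < a) : x < a := by
  have hw : a - I.moment R (I.stageAt R x) ∈ I.waits R (I.stage R (I.stageAt R x)) :=
    Finset.mem_union_right _ (Finset.mem_image.2 ⟨a, Finset.mem_filter.2 ⟨ha, h⟩, rfl⟩)
  have hrun : I.Running R (I.stage R (I.stageAt R x)) := ⟨hact, ⟨_, hw⟩⟩
  have h1 := I.lt_moment_succ_stageAt R (I.lt_lastStage_of_running R hrun)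
  rw [I.moment_succ R hrun] at h1
  have h2 := Finset.min'_le _ _ hw
  linarith

theorem HasFingerprint.act_iff (hf : HasFingerprint R f) {n : ℕ} {u : V} :
    I.Act R n u ↔ ∃ z, I.Conn R n u z ∧ (I.moment R n : EReal) < f z := by
  rw [SteinerForest.act_iff, hf.active_iff]
  simp only [mem_component_iff]

theorem HasFingerprint.lt_of_moment_lt (hf : HasFingerprint R f) {x : ℝ} {z : V}
    (h : (I.moment R (I.stageAt R x) : EReal) < f z) : (x : EReal) < f z := by
  induction hz : f z with
  | top => exact EReal.coe_lt_top x
  | bot => rw [hz] at h; exact absurd h not_lt_bot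
  | coe a =>
    rw [hz, EReal.coe_lt_coe_iff] at h
    rw [EReal.coe_lt_coe_iff]
    refine lt_of_mem_alarms (hf.alarm z a hz) ⟨_, show I.Act R (I.stageAt R x) z from ?_⟩ h
    exact hf.act_iff.2 ⟨z, Conn.refl _ _, by rw [hz]; exact_mod_cast h⟩

/-- Activity can be tested at the actual moment instead of at the start of the step. Runs with
different events thus become comparable moment by moment. -/
theorem HasFingerprint.act_stageAt_iff (hf : HasFingerprint R f) {x : ℝ} (hx : 0 ≤ x) {u : V} :
    I.Act R (I.stageAt R x) u ↔ ∃ z, I.Conn R (I.stageAt R x) u z ∧ (x : EReal) < f z := by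
  rw [hf.act_iff]
  refine exists_congr fun z => and_congr_right fun _ => ⟨hf.lt_of_moment_lt, fun h => ?_⟩
  exact lt_of_le_of_lt (by exact_mod_cast I.moment_stageAt_le R hx) h

theorem Conn.stageAt_mono {x y : ℝ} (hxy : x ≤ y) {u w : V}
    (h : I.Conn R (I.stageAt R x) u w) : I.Conn R (I.stageAt R y) u w :=
  h.mono (I.stageAt_mono R hxy)

/-- A larger fingerprint leads to coarser components. -/
theorem HasFingerprint.conn_mono {R' : MoatRule V} {g : V → EReal} (hf : HasFingerprint R f)
    (hg : HasFingerprint R' g) {x : ℝ} (hx : 0 ≤ x)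
    (hfg : ∀ z, ∀ y : ℝ, y < x → (y : EReal) < f z → (y : EReal) < g z) {u w : V}
    (h : I.Conn R (I.stageAt R x) u w) : I.Conn R' (I.stageAt R' x) u w := by
  have key : ∀ n ≤ I.lastStage R, I.moment R n ≤ x → ∀ u w, I.Conn R n u w →
      I.Conn R' (I.stageAt R' (I.moment R n)) u w := by
    intro n
    induction n using Nat.strong_induction_on with
    | _ n ih =>
    intro hn hnx u w hc
    have hedge : ∀ u w, (I.fullyColoured (I.stage R n)).Adj u w →
        I.Conn R' (I.stageAt R' (I.moment R n)) u w := by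
      rintro u w ⟨hadj, hfull⟩
      -- If the edge still joins different components in `R'`, then by induction it did so in both
      -- runs at all earlier moments, and active endpoints in `R` are active in `R'`. So `R'` has
      -- coloured it at least as fast, although it is full in `R` and not in `R'`.
      by_contra hcon
      have hlt := I.integral_rate_lt R' hadj (I.moment_nonneg R n) hcon
      rw [coloured_eq_sum, ← I.integral_stageAt_moment R (fun k => I.rate R k u w) hn] at hfull
      refine (hfull.trans_lt' hlt).not_ge ?_
      refine intervalIntegral.integral_mono_on_of_le_Ioo (I.moment_nonneg R n)
        (I.intervalIntegrable_stageAt R (fun k => I.rate R k u w) _ _)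
        (I.intervalIntegrable_stageAt R' (fun k => I.rate R' k u w) _ _) fun y hy => ?_
      have hlt := I.stageAt_lt R hy.1.le hy.2
      have hconn : ∀ a c, I.Conn R (I.stageAt R y) a c → I.Conn R' (I.stageAt R' y) a c :=
        fun a c hac => (ih _ hlt (I.stageAt_le R y)
          ((I.moment_stageAt_le R hy.1.le).trans (hy.2.le.trans hnx)) a c hac).stageAt_mono
            (I.moment_stageAt_le R hy.1.le)
      have hact : ∀ a, I.Act R (I.stageAt R y) a → I.Act R' (I.stageAt R' y) a := by
        intro a ha
        obtain ⟨z, hz, hyz⟩ := (hf.act_stageAt_iff hy.1.le).1 ha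
        exact (hg.act_stageAt_iff hy.1.le).2 ⟨z, hconn _ _ hz, hfg z y (hy.2.trans_le hnx) hyz⟩
      have hcon' : ¬ I.Conn R' (I.stageAt R' y) u w := fun h => hcon (h.stageAt_mono hy.2.le)
      have hcon'' : ¬ I.Conn R (I.stageAt R y) u w := fun h => hcon' (hconn _ _ h)
      rw [rate, rate, if_neg hcon', if_neg hcon'']
      have hu := hact u
      have hw := hact w
      split_ifs <;> first | (norm_num; done) | (exfalso; tauto)
    obtain ⟨p⟩ := hc
    induction p with
    | nil => exact Conn.refl _ _
    | cons h p ih => exact (hedge _ _ h).trans ih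
  exact (key _ (I.stageAt_le R x) (I.moment_stageAt_le R hx) u w h).stageAt_mono
    (I.moment_stageAt_le R hx)

theorem HasFingerprint.act_mono {R' : MoatRule V} {g : V → EReal} (hf : HasFingerprint R f)
    (hg : HasFingerprint R' g) {x : ℝ} (hx : 0 ≤ x)
    (hfg : ∀ z, ∀ y : ℝ, y ≤ x → (y : EReal) < f z → (y : EReal) < g z) {u : V}
    (h : I.Act R (I.stageAt R x) u) : I.Act R' (I.stageAt R' x) u := by
  obtain ⟨z, hz, hyz⟩ := (hf.act_stageAt_iff hx).1 h
  exact (hg.act_stageAt_iff hx).2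
    ⟨z, hf.conn_mono hg hx (fun z y hy => hfg z y hy.le) hz, hfg z x le_rfl hyz⟩

theorem hasFingerprint_boostedRule (t b : V → ℝ) :
    HasFingerprint (boostedRule t b) fun z => (b z : EReal) where
  active_iff τ A := by simp [boostedRule]
  alarm z a h := by
    rw [EReal.coe_eq_coe_iff] at h
    simp [boostedRule, ← h]

/-- The value `⊤` keeps `v` active forever and needs no alarm; fingerprints are extended reals for
this purpose. -/
theorem hasFingerprint_foreverRule (b : V → ℝ) (v : V) :
    HasFingerprint (foreverRule b v) (Function.update (fun z => (b z : EReal)) v ⊤) where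
  active_iff τ A := by
    simp only [foreverRule]
    constructor
    · rintro (h | ⟨u, hu, h⟩)
      · exact ⟨v, h, by simp⟩
      · refine ⟨u, hu, ?_⟩
        by_cases huv : u = v
        · subst huv; simp
        · simpa [huv] using h
    · rintro ⟨u, hu, h⟩
      by_cases huv : u = v
      · exact Or.inl (huv ▸ hu)
      · exact Or.inr ⟨u, hu, by simpa [huv] using h⟩
  alarm z a h := by
    by_cases hzv : z = v
    · subst hzv; simp at h
    · simp only [Function.update_of_ne hzv, EReal.coe_eq_coe_iff] at h
      simp [foreverRule, ← h]

/-! ### Distances -/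

variable (I) in
/-- There is a walk from `u` to `w` of cost at most `ℓ`. -/
def DistLE (ℓ : ℝ) (u w : V) : Prop :=
  ∃ p : I.graph.Walk u w, (p.edges.map I.cost).sum ≤ ℓ

theorem DistLE.refl {V : Type*} {I : SteinerForest V} (u : V) :
    I.DistLE 0 u u := ⟨SimpleGraph.Walk.nil, by simp⟩

theorem DistLE.symm {V : Type*} {I : SteinerForest V} {ℓ : ℝ} {u w : V} :
    I.DistLE ℓ u w → I.DistLE ℓ w u := by
  rintro ⟨p, hp⟩
  exact ⟨p.reverse, by simpa using hp⟩

theorem DistLE.trans {V : Type*} {I : SteinerForest V} {ℓ ℓ' : ℝ} {u w z : V} :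
    I.DistLE ℓ u w → I.DistLE ℓ' w z →
    I.DistLE (ℓ + ℓ') u z := by
  rintro ⟨p, hp⟩ ⟨q, hq⟩
  exact ⟨p.append q, by simpa using add_le_add hp hq⟩

theorem DistLE.of_adj {V : Type*} {I : SteinerForest V} {u w : V} (h : I.graph.Adj u w) :
    I.DistLE (I.cost s(u, w)) u w :=
  ⟨h.toWalk, by simp⟩

theorem DistLE.nonneg {V : Type*} {I : SteinerForest V} {ℓ : ℝ} {u w : V} :
    I.DistLE ℓ u w → 0 ≤ ℓ := by
  rintro ⟨p, hp⟩
  refine le_trans (List.sum_nonneg fun x hx => ?_) hp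
  obtain ⟨e, he, rfl⟩ := List.mem_map.1 hx
  exact I.cost_nonneg e (p.edges_subset_edgeSet he)

/-- The number of components of `v` and `a` that separate `w` from `w'`. -/
def separations (I : SteinerForest V) (R : MoatRule V) (v a w w' : V) (n : ℕ) : ℝ :=
  (if I.Conn R n v w ↔ I.Conn R n v w' then 0 else 1) +
    if I.Conn R n a w ↔ I.Conn R n a w' then 0 else 1

/-- The triangle inequality for "separated by a set"; it makes `separations` subadditive along a
walk. -/
theorem ite_iff_trans_le (p q r : Prop) :
    (if p ↔ r then (0 : ℝ) else 1) ≤ (if p ↔ q then 0 else 1) + if q ↔ r then 0 else 1 := by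
  by_cases hp : p <;> by_cases hq : q <;> by_cases hr : r <;> simp [hp, hq, hr]

/-- Here `p`, `p'` and `q`, `q'` say that the two ends of an edge lie in two disjoint active sets,
and `a`, `a'` that the ends are active. Each end lies in at most one of the sets, and only if it is
active. -/
theorem ite_iff_add_ite_iff_le (p p' q q' a a' : Prop) (h1 : p → a) (h2 : p' → a')
    (h3 : q → a) (h4 : q' → a') (h5 : p → ¬ q) (h6 : p' → ¬ q') :
    (if p ↔ p' then (0 : ℝ) else 1) + (if q ↔ q' then 0 else 1) ≤
      (if a then 1 else 0) + if a' then 1 else 0 := by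
  have key : ∀ (p q a : Prop), (p → a) → (q → a) → (p → ¬ q) →
      (if p then (1 : ℝ) else 0) + (if q then 1 else 0) ≤ if a then 1 else 0 := by
    intro p q a h1 h3 h5
    by_cases hp : p
    · simp [hp, h1 hp, h5 hp]
    · by_cases hq : q
      · simp [hp, hq, h3 hq]
      · simp only [hp, hq, if_false]
        split_ifs <;> norm_num
  have hle : ∀ (p p' : Prop), (if p ↔ p' then (0 : ℝ) else 1) ≤
      (if p then 1 else 0) + if p' then 1 else 0 := by
    intro p p'
    by_cases hp : p <;> by_cases hp' : p' <;> simp [hp, hp']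
  linarith [key p q a h1 h3 h5, key p' q' a' h2 h4 h6, hle p p', hle q q']

theorem separations_le_rate {v a w w' : V} {n : ℕ} (hv : I.Act R n v) (ha : I.Act R n a)
    (hva : ¬ I.Conn R n v a) : separations I R v a w w' n ≤ I.rate R n w w' := by
  by_cases hc : I.Conn R n w w'
  · have h1 : I.Conn R n v w ↔ I.Conn R n v w' := ⟨fun h => h.trans hc, fun h => h.trans hc.symm⟩
    have h2 : I.Conn R n a w ↔ I.Conn R n a w' := ⟨fun h => h.trans hc, fun h => h.trans hc.symm⟩
    rw [separations, rate, if_pos hc, if_pos h1, if_pos h2, add_zero]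
  · rw [separations, rate, if_neg hc]
    exact ite_iff_add_ite_iff_le _ _ _ _ _ _ (fun h => (Act.congr h).1 hv)
      (fun h => (Act.congr h).1 hv) (fun h => (Act.congr h).1 ha) (fun h => (Act.congr h).1 ha)
      (fun h h' => hva (h.trans h'.symm)) fun h h' => hva (h.trans h'.symm)

/-- Up to `x`, the components of `v` and `a` are disjoint and active, and each of them separates the
ends of any walk between them. Both therefore colour the walk at unit rate, and no edge is coloured
beyond its cost. -/
theorem two_mul_le_of_not_conn {v a : V} {x ℓ : ℝ} (hx : 0 ≤ x)
    (hv : ∀ y, 0 ≤ y → y < x → I.Act R (I.stageAt R y) v)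
    (ha : ∀ y, 0 ≤ y → y < x → I.Act R (I.stageAt R y) a)
    (hva : ¬ I.Conn R (I.stageAt R x) v a) (hd : I.DistLE ℓ v a) : 2 * x ≤ ℓ := by
  obtain ⟨p, hp⟩ := hd
  refine le_trans ?_ hp
  have hva' : ∀ y, y < x → ¬ I.Conn R (I.stageAt R y) v a := fun y hy h =>
    hva (h.stageAt_mono hy.le)
  have key : ∀ w w' (q : I.graph.Walk w w'),
      ∫ y in (0 : ℝ)..x, separations I R v a w w' (I.stageAt R y) ≤ (q.edges.map I.cost).sum := by
    intro w w' q
    induction q with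
    | nil => simp [separations]
    | @cons w z w' h q ih =>
      rw [SimpleGraph.Walk.edges_cons, List.map_cons, List.sum_cons]
      refine le_trans ?_ (add_le_add (I.integral_rate_le R h hx) ih)
      rw [← intervalIntegral.integral_add
        (I.intervalIntegrable_stageAt R (fun k => I.rate R k w z) _ _)
        (I.intervalIntegrable_stageAt R (separations I R v a z w') _ _)]
      refine intervalIntegral.integral_mono_on_of_le_Ioo hx
        (I.intervalIntegrable_stageAt R (separations I R v a w w') _ _)
        (I.intervalIntegrable_stageAt R
          (fun k => I.rate R k w z + separations I R v a z w' k) _ _) fun y hy => ?_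
      have h1 := separations_le_rate (w := w) (w' := z) (hv y hy.1.le hy.2) (ha y hy.1.le hy.2)
        (hva' y hy.2)
      refine le_trans ?_ (add_le_add h1 le_rfl)
      have h2 := ite_iff_trans_le (I.Conn R (I.stageAt R y) v w) (I.Conn R (I.stageAt R y) v z)
        (I.Conn R (I.stageAt R y) v w')
      have h3 := ite_iff_trans_le (I.Conn R (I.stageAt R y) a w) (I.Conn R (I.stageAt R y) a z)
        (I.Conn R (I.stageAt R y) a w')
      unfold separations
      linarith
  refine le_trans (le_of_eq ?_) (key v a p)
  rw [intervalIntegral.integral_congr_Ioo_of_le (g := fun _ => (2 : ℝ)) hx]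
  · simp [mul_comm]
  · intro y hy
    have h1 := hva' y hy.2
    have h2 : ¬ I.Conn R (I.stageAt R y) a v := fun h => h1 h.symm
    simp only [separations, Conn.refl, h1, h2, iff_false, iff_true, not_true, if_false]
    norm_num

variable (I R)

/-! ### The potential of the local search -/

/-- Distinct elements of `s'` have distinct representatives in `s`. All of `X` has one image under
`π`, so at most one element of `X` is a representative; every other one is saved, with weight at
least 1. -/
theorem sum_add_card_sub_one_le {ι κ : Type*} [Nonempty ι] (s X : Finset ι) (s' : Finset κ)
    (π : ι → κ) (w : ι → ℝ) (w' : κ → ℝ) (hsec : ∀ c ∈ s', ∃ a ∈ s, π a = c ∧ w' c ≤ w a)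
    (hw : ∀ a ∈ s, 1 ≤ w a) (hXs : X ⊆ s) (hX : ∀ a ∈ X, ∀ a' ∈ X, π a = π a') :
    ∑ c ∈ s', w' c + ((X.card - 1 : ℕ) : ℝ) ≤ ∑ a ∈ s, w a := by
  choose! ρ hρs hρπ hρw using hsec
  have hinj : Set.InjOn ρ s' := fun c hc c' hc' h => by rw [← hρπ c hc, ← hρπ c' hc', h]
  have hsub : s'.image ρ ⊆ s := Finset.image_subset_iff.2 hρs
  have h1 : ∑ c ∈ s', w' c ≤ ∑ a ∈ s'.image ρ, w a := by
    rw [Finset.sum_image hinj]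
    exact Finset.sum_le_sum hρw
  have h2 : (X ∩ s'.image ρ).card ≤ 1 := by
    rw [Finset.card_le_one]
    intro a ha a' ha'
    obtain ⟨haX, c, hc, rfl⟩ := by simpa using ha
    obtain ⟨haX', c', hc', rfl⟩ := by simpa using ha'
    have := hX _ haX _ haX'
    rw [hρπ c hc, hρπ c' hc'] at this
    rw [this]
  have h3 : X.card - 1 ≤ (X \ s'.image ρ).card := by
    have := Finset.card_sdiff_add_card_inter X (s'.image ρ)
    omega
  have h4 : ((X \ s'.image ρ).card : ℝ) ≤ ∑ a ∈ X \ s'.image ρ, w a := by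
    have := Finset.card_nsmul_le_sum (X \ s'.image ρ) w 1 fun a ha =>
      hw a (hXs (Finset.mem_sdiff.1 ha).1)
    simpa using this
  have h5 : ∑ a ∈ X \ s'.image ρ, w a ≤ ∑ a ∈ s \ s'.image ρ, w a :=
    Finset.sum_le_sum_of_subset_of_nonneg (Finset.sdiff_subset_sdiff hXs le_rfl)
      fun a ha _ => zero_le_one.trans (hw a (Finset.mem_sdiff.1 ha).1)
  have h6 := Finset.sum_sdiff (f := w) hsub
  have h7 : ((X.card - 1 : ℕ) : ℝ) ≤ ((X \ s'.image ρ).card : ℝ) := by exact_mod_cast h3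
  linarith

/-- The weighted number of active sets at stage `n`: a set that is active only thanks to boosting
counts `1 + β`. -/
def potential (β : ℝ) (t : V → ℝ) (n : ℕ) : ℝ :=
  ∑ A ∈ I.activeSets R (I.stage R n), if ∃ z ∈ A, I.moment R n < t z then 1 else 1 + β

variable {I R}

/-- The values of `t` are alarms, so whether an active set counts as base or as boost is constant
during a step. -/
theorem potential_stageAt (β : ℝ) (t b : V → ℝ) {y : ℝ} (hy : 0 ≤ y) :
    I.potential (boostedRule t b) β t (I.stageAt (boostedRule t b) y) =
      ∑ A ∈ I.activeSets (boostedRule t b) (I.stage (boostedRule t b)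
        (I.stageAt (boostedRule t b) y)),
        if ∃ z ∈ A, y < t z then 1 else 1 + β := by
  refine Finset.sum_congr rfl fun A hA => if_congr (exists_congr fun z => and_congr_right fun _ =>
    ⟨fun h => lt_of_mem_alarms (by simp [boostedRule]) ⟨A, hA⟩ h, fun h =>
      (I.moment_stageAt_le _ hy).trans_lt h⟩) rfl rfl

theorem activeSets_lastStage_boostedRule (t b : V → ℝ) :
    I.activeSets (boostedRule t b) (I.stage (boostedRule t b) (I.lastStage (boostedRule t b))) =
      ∅ := by
  by_contra h
  obtain ⟨A, hA⟩ := Finset.nonempty_iff_ne_empty.2 h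
  obtain ⟨⟨u, rfl⟩, hact⟩ := mem_activeSets_iff.1 hA
  obtain ⟨z, -, hz⟩ := hact
  -- If `z` keeps a set active at the end, the alarm `b z` is still ahead. At the moment `b z` the
  -- last stage is current, so this would give `b z < b z`.
  have key := lt_of_mem_alarms (I := I) (R := boostedRule t b) (x := b z) (a := b z)
    (by simp [boostedRule])
  rw [(I.stageAt_le _ _).antisymm (I.le_stageAt _ le_rfl hz.le)] at key
  exact lt_irrefl _ (key ⟨_, hA⟩ hz)

/-- After the end the potential vanishes, so any later horizon works; two runs can share one. -/
theorem yBase_add_mul_yBoost (β : ℝ) (t b : V → ℝ) {H : ℝ}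
    (hH : I.moment (boostedRule t b) (I.lastStage (boostedRule t b)) ≤ H) :
    I.yBase t b + (1 + β) * I.yBoost t b =
      ∫ y in (0 : ℝ)..H, I.potential (boostedRule t b) β t (I.stageAt (boostedRule t b) y) := by
  rw [I.integral_stageAt _ _ ((I.moment_nonneg _ _).trans hH),
    (I.stageAt_le _ H).antisymm (I.le_stageAt _ le_rfl hH)]
  have h0 : I.potential (boostedRule t b) β t (I.lastStage (boostedRule t b)) = 0 := by
    rw [potential, activeSets_lastStage_boostedRule, Finset.sum_empty]
  rw [h0, mul_zero, add_zero, yBase, yBoost, Finset.mul_sum, ← Finset.sum_add_distrib]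
  refine Finset.sum_congr rfl fun n _ => ?_
  rw [Finset.sum_filter, Finset.sum_filter, Finset.mul_sum, ← Finset.sum_add_distrib, potential,
    Finset.mul_sum]
  refine Finset.sum_congr rfl fun A _ => ?_
  by_cases h : ∃ z ∈ A, (I.stage (boostedRule t b) n).time < t z
  · rw [if_pos h, if_neg (not_not.2 h),
      if_pos (show ∃ z ∈ A, I.moment (boostedRule t b) n < t z from h)]
    unfold moment
    ring
  · rw [if_neg h, if_pos h,
      if_neg (show ¬ ∃ z ∈ A, I.moment (boostedRule t b) n < t z from h)]
    unfold moment
    ring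

variable (I R)

/-- The number of components at stage `n` that contain a vertex of `X`. -/
def touched (n : ℕ) (X : Finset V) : ℕ := (X.image (I.component (I.stage R n))).card

variable {I R}

theorem touched_insert_le (n : ℕ) (q : V) (X : Finset V) :
    I.touched R n (insert q X) ≤ I.touched R n X + 1 := by
  unfold touched
  rw [Finset.image_insert]
  exact Finset.card_insert_le _ _

theorem touched_le_one {n : ℕ} {X : Finset V} (h : ∀ u ∈ X, ∀ w ∈ X, I.Conn R n u w) :
    I.touched R n X ≤ 1 := by
  rw [touched, Finset.card_le_one]
  simp only [Finset.mem_image]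
  rintro _ ⟨u, hu, rfl⟩ _ ⟨w, hw, rfl⟩
  exact component_eq_iff_conn.2 (h u hu w hw)

/-! ### The effect of a single boost action on the potential -/

section Boost

variable {β : ℝ} {t b : V → ℝ} {v : V} {σ y : ℝ}

/-- Sets of the boosted run that are active thanks to the old fingerprint are represented by active
components of the old run, as the boosted components are coarser. The old components meeting `Q`
have all been merged with `v`, and only one of them can be a representative. -/
theorem potential_boost_le_of_forall_exists (hβ : 0 ≤ β) (hσ : b v ≤ σ) (hy : 0 ≤ y)
    {s' : Finset (Finset V)}
    (hs' : ∀ C ∈ s', ∃ u z, C = I.component (I.stage (boostedRule t (Function.update b v σ))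
      (I.stageAt (boostedRule t (Function.update b v σ)) y)) u ∧
      I.Conn (boostedRule t (Function.update b v σ))
        (I.stageAt (boostedRule t (Function.update b v σ)) y) u z ∧ y < b z)
    {Q : Finset V}
    (hQ : ∀ q ∈ Q, I.Act (boostedRule t b) (I.stageAt (boostedRule t b) y) q ∧
      I.Conn (boostedRule t (Function.update b v σ))
        (I.stageAt (boostedRule t (Function.update b v σ)) y) v q) :
    ∑ C ∈ s', (if ∃ z ∈ C, y < t z then 1 else 1 + β) +
        ((I.touched (boostedRule t b) (I.stageAt (boostedRule t b) y) Q - 1 : ℕ) : ℝ) ≤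
      I.potential (boostedRule t b) β t (I.stageAt (boostedRule t b) y) := by
  rw [potential_stageAt β t b hy]
  have hf := hasFingerprint_boostedRule t b
  have hg := hasFingerprint_boostedRule t (Function.update b v σ)
  set R := boostedRule t b
  set R' := boostedRule t (Function.update b v σ)
  have hle : ∀ z, b z ≤ Function.update b v σ z := by
    intro z
    by_cases hz : z = v
    · subst hz; simpa using hσ
    · simp [hz]
  have hconn : ∀ u w, I.Conn R (I.stageAt R y) u w → I.Conn R' (I.stageAt R' y) u w :=
    fun u w h => hf.conn_mono hg hy (fun z x _ hx => hx.trans_le (by exact_mod_cast hle z)) h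
  let π : Finset V → Finset V := fun C =>
    Finset.univ.filter fun w => ∃ x ∈ C, I.Conn R' (I.stageAt R' y) x w
  have hπ : ∀ u, π (I.component (I.stage R (I.stageAt R y)) u) =
      I.component (I.stage R' (I.stageAt R' y)) u := by
    intro u
    ext w
    simp only [π, Finset.mem_filter, Finset.mem_univ, true_and, mem_component_iff]
    exact ⟨fun ⟨x, hx, h⟩ => (hconn _ _ hx).trans h, fun h => ⟨u, Conn.refl _ _, h⟩⟩
  refine sum_add_card_sub_one_le _ (Q.image (I.component (I.stage R (I.stageAt R y)))) s' π _ _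
    ?_ ?_ ?_ ?_
  · intro C hC
    obtain ⟨u, z, rfl, huz, hz⟩ := hs' C hC
    refine ⟨I.component (I.stage R (I.stageAt R y)) z, ?_, ?_, ?_⟩
    · exact (hf.act_stageAt_iff hy).2 ⟨z, Conn.refl _ _, by exact_mod_cast hz⟩
    · rw [hπ]
      exact (component_eq_iff_conn.2 huz).symm
    -- The old component of `z` lies inside `C`: if it counts as base, so does `C`, and the weight
    -- cannot be larger after the boost.
    · split_ifs with h1 h2 h2
      · exact le_rfl
      · linarith
      · obtain ⟨x, hx, hxt⟩ := h2
        exact absurd ⟨x, mem_component_iff.2 (huz.trans (hconn _ _ (mem_component_iff.1 hx))), hxt⟩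
          h1
      · exact le_rfl
  · intro A _
    split_ifs
    · exact le_rfl
    · linarith
  · exact Finset.image_subset_iff.2 fun q hq => (hQ q hq).1
  · simp only [Finset.mem_image]
    rintro _ ⟨q, hq, rfl⟩ _ ⟨q', hq', rfl⟩
    rw [hπ, hπ]
    exact component_eq_iff_conn.2 ((hQ q hq).2.symm.trans (hQ q' hq').2)

/-- Only the component of `v` can owe its activity to the new value `σ`. -/
theorem exists_of_mem_activeSets_boost (hy : 0 ≤ y) {C : Finset V}
    (hC : C ∈ I.activeSets (boostedRule t (Function.update b v σ))
      (I.stage (boostedRule t (Function.update b v σ))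
        (I.stageAt (boostedRule t (Function.update b v σ)) y)))
    (h : v ∈ C → ∃ z ∈ C, y < b z) :
    ∃ u z, C = I.component (I.stage (boostedRule t (Function.update b v σ))
      (I.stageAt (boostedRule t (Function.update b v σ)) y)) u ∧
      I.Conn (boostedRule t (Function.update b v σ))
        (I.stageAt (boostedRule t (Function.update b v σ)) y) u z ∧ y < b z := by
  obtain ⟨⟨u, rfl⟩, -⟩ := mem_activeSets_iff.1 hC
  by_cases hv : v ∈ I.component (I.stage (boostedRule t (Function.update b v σ))
      (I.stageAt (boostedRule t (Function.update b v σ)) y)) u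
  · obtain ⟨z, hz, hyz⟩ := h hv
    exact ⟨u, z, rfl, mem_component_iff.1 hz, hyz⟩
  · obtain ⟨z, hz, hyz⟩ := ((hasFingerprint_boostedRule t _).act_stageAt_iff hy).1 hC
    refine ⟨u, z, rfl, hz, ?_⟩
    have hzv : z ≠ v := fun h => hv (mem_component_iff.2 (h ▸ hz))
    simpa [hzv] using hyz

theorem potential_boost_le_add (hβ : 0 ≤ β) (hσ : b v ≤ σ) (hy : 0 ≤ y) :
    I.potential (boostedRule t (Function.update b v σ)) β t
        (I.stageAt (boostedRule t (Function.update b v σ)) y) ≤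
      I.potential (boostedRule t b) β t (I.stageAt (boostedRule t b) y) + (1 + β) := by
  have key := potential_boost_le_of_forall_exists (I := I) (t := t) hβ hσ hy
    (s' := (I.activeSets (boostedRule t (Function.update b v σ))
      (I.stage (boostedRule t (Function.update b v σ))
        (I.stageAt (boostedRule t (Function.update b v σ)) y))).filter (v ∉ ·))
    (Q := ∅) (fun C hC => exists_of_mem_activeSets_boost hy (Finset.mem_filter.1 hC).1
      fun hv => absurd hv (Finset.mem_filter.1 hC).2) (by simp)
  rw [potential_stageAt β t _ hy, ← Finset.sum_filter_add_sum_filter_not _ (v ∉ ·)]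
  have h1 : ((I.touched (boostedRule t b) (I.stageAt (boostedRule t b) y) ∅ - 1 : ℕ) : ℝ) = 0 := by
    simp [touched]
  have h2 : ((I.activeSets (boostedRule t (Function.update b v σ))
      (I.stage (boostedRule t (Function.update b v σ))
        (I.stageAt (boostedRule t (Function.update b v σ)) y))).filter
        (¬ v ∉ ·)).card ≤ 1 := by
    rw [Finset.card_le_one]
    simp only [Finset.mem_filter, not_not]
    rintro A ⟨hA, hvA⟩ C ⟨hC, hvC⟩
    rw [← component_of_mem_activeSets hA hvA, ← component_of_mem_activeSets hC hvC]
  have h3 := Finset.sum_le_card_nsmul ((I.activeSets (boostedRule t (Function.update b v σ))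
      (I.stage (boostedRule t (Function.update b v σ))
        (I.stageAt (boostedRule t (Function.update b v σ)) y))).filter (¬ v ∉ ·))
    (fun C => if ∃ z ∈ C, y < t z then (1 : ℝ) else 1 + β) (1 + β) (fun C _ => by
      split_ifs <;> linarith)
  have h4 : (((I.activeSets (boostedRule t (Function.update b v σ))
      (I.stage (boostedRule t (Function.update b v σ))
        (I.stageAt (boostedRule t (Function.update b v σ)) y))).filter
        (¬ v ∉ ·)).card : ℝ) ≤ 1 := by exact_mod_cast h2
  rw [nsmul_eq_mul] at h3
  have h5 := mul_le_mul_of_nonneg_right h4 (by linarith : 0 ≤ 1 + β)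
  linarith

/-- Once `v` has met a vertex active in the old run, its component is active under the old
fingerprint as well, so the boost creates no additional active set. -/
theorem potential_boost_add_touched_le (hβ : 0 ≤ β) (hσ : b v ≤ σ) (hy : 0 ≤ y) {Q : Finset V}
    (hne : Q.Nonempty) (hQ : ∀ q ∈ Q, I.Act (boostedRule t b) (I.stageAt (boostedRule t b) y) q ∧
      I.Conn (boostedRule t (Function.update b v σ))
        (I.stageAt (boostedRule t (Function.update b v σ)) y) v q) :
    I.potential (boostedRule t (Function.update b v σ)) β t
        (I.stageAt (boostedRule t (Function.update b v σ)) y) +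
          ((I.touched (boostedRule t b) (I.stageAt (boostedRule t b) y) Q : ℝ) - 1) ≤
      I.potential (boostedRule t b) β t (I.stageAt (boostedRule t b) y) := by
  rw [potential_stageAt β t (Function.update b v σ) hy]
  refine le_trans ?_ (potential_boost_le_of_forall_exists (I := I) (t := t) hβ hσ hy (Q := Q)
    (fun C hC => exists_of_mem_activeSets_boost hy hC fun hv => ?_) hQ)
  · have h1 : (I.touched (boostedRule t b) (I.stageAt (boostedRule t b) y) Q : ℝ) - 1 ≤
        ((I.touched (boostedRule t b) (I.stageAt (boostedRule t b) y) Q - 1 : ℕ) : ℝ) := by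
      rw [sub_le_iff_le_add]
      exact_mod_cast Nat.le_add_of_sub_le le_rfl
    linarith
  · obtain ⟨q, hq⟩ := hne
    obtain ⟨hact, hc⟩ := hQ q hq
    obtain ⟨z, hz, hyz⟩ := ((hasFingerprint_boostedRule t b).act_stageAt_iff hy).1 hact
    refine ⟨z, ?_, by exact_mod_cast hyz⟩
    rw [← component_of_mem_activeSets hC hv, mem_component_iff]
    refine hc.trans ((hasFingerprint_boostedRule t b).conn_mono
      (hasFingerprint_boostedRule t _) hy (fun x w _ hx => hx.trans_le ?_) hz)
    by_cases hxv : x = v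
    · subst hxv; simpa using hσ
    · simp [hxv]

/-- From `σ` on, `v` no longer keeps its component active; only the merging effect of the boost
remains. -/
theorem potential_boost_le (hβ : 0 ≤ β) (hσ : b v ≤ σ) (hy : 0 ≤ y) (hσy : σ ≤ y) :
    I.potential (boostedRule t (Function.update b v σ)) β t
        (I.stageAt (boostedRule t (Function.update b v σ)) y) ≤
      I.potential (boostedRule t b) β t (I.stageAt (boostedRule t b) y) := by
  rw [potential_stageAt β t (Function.update b v σ) hy]
  refine le_trans ?_ (potential_boost_le_of_forall_exists (I := I) (t := t) hβ hσ hy (Q := ∅)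
    (fun C hC => exists_of_mem_activeSets_boost hy hC fun hv => ?_) (by simp))
  · simp
  · obtain ⟨z, hz, hyz⟩ := ((hasFingerprint_boostedRule t _).act_stageAt_iff hy).1
      (show I.Act _ _ v by rw [Act, component_of_mem_activeSets hC hv]; exact hC)
    rw [← component_of_mem_activeSets hC hv]
    refine ⟨z, mem_component_iff.2 hz, ?_⟩
    by_cases hzv : z = v
    · subst hzv
      simp only [Function.update_self, EReal.coe_lt_coe_iff] at hyz
      linarith
    · simpa [hzv] using hyz

end Boost

variable (I R)

/-! ### Merging three terminals -/

/-- The time integral, up to the moment `H`, of the number of components that have to be merged in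
order to connect all vertices of `X`. -/
def excess (H : ℝ) (X : Finset V) : ℝ :=
  ∫ y in (0 : ℝ)..H, ((I.touched R (I.stageAt R y) X : ℝ) - 1)

variable {I R}

theorem intervalIntegrable_ite_le (x a c : ℝ) :
    IntervalIntegrable (fun y : ℝ => if y ≤ x then (1 : ℝ) else 0) volume a c := by
  refine Antitone.intervalIntegrable fun y z hyz => ?_
  split_ifs <;> first | (norm_num; done) | (exfalso; linarith)

theorem integral_ite_le_le {x H : ℝ} (hx : 0 ≤ x) (hH : 0 ≤ H) :
    ∫ y in (0 : ℝ)..H, (if y ≤ x then (1 : ℝ) else 0) ≤ x := by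
  rcases le_total H x with h | h
  · rw [intervalIntegral.integral_congr_Ioo_of_le (g := fun _ => (1 : ℝ)) hH]
    · simpa using h
    · intro y hy
      simp [hy.2.le.trans h]
  · rw [← intervalIntegral.integral_add_adjacent_intervals (intervalIntegrable_ite_le x 0 x)
      (intervalIntegrable_ite_le x x H),
      intervalIntegral.integral_congr_Ioo_of_le (g := fun _ => (1 : ℝ)) hx,
      intervalIntegral.integral_congr_Ioo_of_le (a := x) (g := fun _ => (0 : ℝ)) h]
    · simp
    · intro y hy
      simp [not_le.2 hy.1]
    · intro y hy
      simp [hy.2.le]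

theorem excess_le_add {H x₂ x₃ : ℝ} (hH : 0 ≤ H) (h₂ : 0 ≤ x₂) (h₃ : 0 ≤ x₃) {X : Finset V}
    (h : ∀ y, 0 < y → y < H → (I.touched R (I.stageAt R y) X : ℝ) - 1 ≤
      (if y ≤ x₂ then 1 else 0) + if y ≤ x₃ then 1 else 0) :
    I.excess R H X ≤ x₂ + x₃ := by
  refine le_trans ?_ (add_le_add (integral_ite_le_le h₂ hH) (integral_ite_le_le h₃ hH))
  rw [← intervalIntegral.integral_add (intervalIntegrable_ite_le _ _ _)
    (intervalIntegrable_ite_le _ _ _)]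
  exact intervalIntegral.integral_mono_on_of_le_Ioo hH
    (I.intervalIntegrable_stageAt R (fun n => (I.touched R n X : ℝ) - 1) _ _)
    ((intervalIntegrable_ite_le _ _ _).add (intervalIntegrable_ite_le _ _ _))
    fun y hy => h y hy.1 hy.2

/-- The terminals among `q₁`, `q₂`, `q₃` at distance less than `y`; the first one is always
included. -/
def near (q₁ q₂ q₃ : V) (x₂ x₃ y : ℝ) : Finset V :=
  {q₁, if y ≤ x₂ then q₁ else q₂, if y ≤ x₃ then q₁ else q₃}

/-- Each terminal that is not yet near meets at most one further component. -/
theorem touched_triple_le (n : ℕ) (q₁ q₂ q₃ : V) (x₂ x₃ y : ℝ) :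
    (I.touched R n {q₁, q₂, q₃} : ℝ) ≤ I.touched R n (near q₁ q₂ q₃ x₂ x₃ y) +
      (if y ≤ x₂ then 1 else 0) + if y ≤ x₃ then 1 else 0 := by
  have h2 := I.touched_insert_le (R := R) n q₂ {q₁, q₃}
  have h3 := I.touched_insert_le (R := R) n q₃ {q₁, q₂}
  have h3' := I.touched_insert_le (R := R) n q₃ {q₁}
  have e2 : ({q₁, q₂, q₃} : Finset V) = {q₂, q₁, q₃} := Finset.insert_comm _ _ _
  have e3 : ({q₁, q₂, q₃} : Finset V) = {q₃, q₁, q₂} := by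
    ext; simp; tauto
  have e4 : ({q₁, q₃} : Finset V) = {q₃, q₁} := Finset.pair_comm _ _
  have e5 : ({q₁, q₁, q₃} : Finset V) = {q₁, q₃} := by simp
  have e6 : ({q₁, q₂, q₁} : Finset V) = {q₁, q₂} := by
    rw [Finset.pair_comm q₂]; simp
  have e7 : ({q₁, q₁, q₁} : Finset V) = {q₁} := by simp
  unfold near
  split_ifs
  · rw [e7, e2, add_assoc]
    rw [e4] at h2 ⊢
    norm_num
    exact_mod_cast (by omega : I.touched R n {q₂, q₃, q₁} ≤ I.touched R n {q₁} + 2)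
  · rw [e5, e2, add_zero]
    exact_mod_cast h2
  · rw [e6, e3, add_zero]
    exact_mod_cast h3
  · simp

theorem touched_triple_sub_one_le {n : ℕ} {q₁ q₂ q₃ : V} {x₁ x₂ x₃ y : ℝ} (h₁₂ : x₁ ≤ x₂)
    (h₁₃ : x₁ ≤ x₃) (h : x₁ < y → ∀ q ∈ near q₁ q₂ q₃ x₂ x₃ y, I.Conn R n q₁ q) :
    (I.touched R n {q₁, q₂, q₃} : ℝ) - 1 ≤
      (if y ≤ x₂ then 1 else 0) + if y ≤ x₃ then 1 else 0 := by
  have h1 := touched_triple_le (I := I) (R := R) n q₁ q₂ q₃ x₂ x₃ y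
  have h2 : (I.touched R n (near q₁ q₂ q₃ x₂ x₃ y) : ℝ) ≤ 1 := by
    have : I.touched R n (near q₁ q₂ q₃ x₂ x₃ y) ≤ 1 := by
      by_cases hy : x₁ < y
      · exact touched_le_one fun u hu w hw => (h hy u hu).symm.trans (h hy w hw)
      · have e2 : y ≤ x₂ := (not_lt.1 hy).trans h₁₂
        have e3 : y ≤ x₃ := (not_lt.1 hy).trans h₁₃
        simp [near, e2, e3, touched]
    exact_mod_cast this
  linarith

/-! ### The star bound from local optimality -/

section Star

variable {β : ℝ} {t b : V → ℝ} {H : ℝ} {v q₁ q₂ q₃ : V} {a₁ a₂ a₃ : ℝ}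

/-- The balance of one boost: `(1 + β) * x₁` pays for the additional set of `v` before it reaches
`q₁`, and `x₂ + x₃` for the components of terminals not yet reached. The remaining part of the
excess is saved. -/
theorem excess_add_le_of_conn (hβ : 0 ≤ β) {σ x₁ x₂ x₃ : ℝ} (hσ : b v ≤ σ) (hσH : σ ≤ H)
    (hH : 0 ≤ H) (h₁ : 0 ≤ x₁) (h₁₂ : x₁ ≤ x₂) (h₁₃ : x₁ ≤ x₃)
    (hact : ∀ q ∈ ({q₁, q₂, q₃} : Finset V), ∀ y, 0 ≤ y → y < H →
      I.Act (boostedRule t b) (I.stageAt (boostedRule t b) y) q)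
    (hconn : ∀ y, 0 < y → y < H → x₁ < y → ∀ q ∈ near q₁ q₂ q₃ x₂ x₃ y,
      I.Conn (boostedRule t (Function.update b v σ))
        (I.stageAt (boostedRule t (Function.update b v σ)) y) v q) :
    I.yBase t (Function.update b v σ) + (1 + β) * I.yBoost t (Function.update b v σ) +
        I.excess (boostedRule t b) H {q₁, q₂, q₃} ≤
      I.yBase t b + (1 + β) * I.yBoost t b + (x₂ + x₃ + (1 + β) * x₁) := by
  set R := boostedRule t b with hR
  set R' := boostedRule t (Function.update b v σ) with hR'
  obtain ⟨L, hHL, hL, hL'⟩ : ∃ L, H ≤ L ∧ I.moment R (I.lastStage R) ≤ L ∧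
      I.moment R' (I.lastStage R') ≤ L :=
    ⟨max H (max (I.moment R (I.lastStage R)) (I.moment R' (I.lastStage R'))), le_max_left _ _,
      (le_max_left _ _).trans (le_max_right _ _), (le_max_right _ _).trans (le_max_right _ _)⟩
  have hint : ∀ a c, IntervalIntegrable (fun y => I.potential R β t (I.stageAt R y)) volume a c :=
    fun a c => I.intervalIntegrable_stageAt R (I.potential R β t) a c
  have hint' : ∀ a c,
      IntervalIntegrable (fun y => I.potential R' β t (I.stageAt R' y)) volume a c :=
    fun a c => I.intervalIntegrable_stageAt R' (I.potential R' β t) a c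
  have hintk : IntervalIntegrable (fun y => (I.touched R (I.stageAt R y) {q₁, q₂, q₃} : ℝ) - 1)
      volume 0 H :=
    I.intervalIntegrable_stageAt R (fun n => (I.touched R n {q₁, q₂, q₃} : ℝ) - 1) 0 H
  rw [yBase_add_mul_yBoost β t b hL, yBase_add_mul_yBoost β t _ hL',
    ← intervalIntegral.integral_add_adjacent_intervals (hint 0 H) (hint H L),
    ← intervalIntegral.integral_add_adjacent_intervals (hint' 0 H) (hint' H L)]
  have hlate : ∫ y in H..L, I.potential R' β t (I.stageAt R' y) ≤
      ∫ y in H..L, I.potential R β t (I.stageAt R y) :=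
    intervalIntegral.integral_mono_on_of_le_Ioo hHL (hint' H L) (hint H L) fun y hy =>
      potential_boost_le hβ hσ (hH.trans hy.1.le) (hσH.trans hy.1.le)
  have hearly : ∫ y in (0 : ℝ)..H, (I.potential R' β t (I.stageAt R' y) +
        ((I.touched R (I.stageAt R y) {q₁, q₂, q₃} : ℝ) - 1)) ≤
      ∫ y in (0 : ℝ)..H, (I.potential R β t (I.stageAt R y) +
        (((if y ≤ x₂ then 1 else 0) + if y ≤ x₃ then 1 else 0) +
          (1 + β) * if y ≤ x₁ then 1 else 0)) := by
    refine intervalIntegral.integral_mono_on_of_le_Ioo hH ((hint' 0 H).add hintk)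
      ((hint 0 H).add (((intervalIntegrable_ite_le _ _ _).add
        (intervalIntegrable_ite_le _ _ _)).add ((intervalIntegrable_ite_le _ _ _).const_mul _)))
      fun y hy => ?_
    by_cases hy1 : y ≤ x₁
    · have h1 := potential_boost_le_add (I := I) (t := t) hβ hσ hy.1.le
      have h2 := touched_triple_sub_one_le (I := I) (R := R) (n := I.stageAt R y) (q₁ := q₁)
        (q₂ := q₂) (q₃ := q₃) h₁₂ h₁₃ (fun h => absurd hy1 (not_le.2 h))
      rw [if_pos hy1]
      linarith
    · rw [not_le] at hy1
      have h1 := potential_boost_add_touched_le (I := I) (t := t) hβ hσ hy.1.le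
        (Q := near q₁ q₂ q₃ x₂ x₃ y) ⟨q₁, by simp [near]⟩ fun q hq =>
          ⟨hact q (by
            simp only [near, Finset.mem_insert, Finset.mem_singleton] at hq ⊢
            split_ifs at hq <;> tauto) y hy.1.le hy.2, hconn y hy.1 hy.2 hy1 q hq⟩
      have h2 := touched_triple_le (I := I) (R := R) (I.stageAt R y) q₁ q₂ q₃ x₂ x₃ y
      rw [if_neg (not_le.2 hy1)]
      linarith
  rw [intervalIntegral.integral_add (hint' 0 H) hintk,
    intervalIntegral.integral_add (hint 0 H) (((intervalIntegrable_ite_le _ _ _).add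
        (intervalIntegrable_ite_le _ _ _)).add ((intervalIntegrable_ite_le _ _ _).const_mul _)),
    intervalIntegral.integral_add ((intervalIntegrable_ite_le _ _ _).add
        (intervalIntegrable_ite_le _ _ _)) ((intervalIntegrable_ite_le _ _ _).const_mul _),
    intervalIntegral.integral_add (intervalIntegrable_ite_le _ _ _)
        (intervalIntegrable_ite_le _ _ _), intervalIntegral.integral_const_mul] at hearly
  have i1 := integral_ite_le_le h₁ hH
  have i2 := integral_ite_le_le (h₁.trans h₁₂) hH
  have i3 := integral_ite_le_le (h₁.trans h₁₃) hH
  have i1' := mul_le_mul_of_nonneg_left i1 (by linarith : 0 ≤ 1 + β)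
  rw [excess]
  linarith

/-- In a local optimum, the terminals of a star with center `v` merge early. -/
theorem two_mul_excess_star_le (hβ : 0 ≤ β)
    (hloc : ∀ v τ, I.IsBoostCandidate b v τ → ¬ I.Valuable β t b v τ) (hH : 0 ≤ H)
    (hact : ∀ q ∈ ({q₁, q₂, q₃} : Finset V), ∀ y, 0 ≤ y → y < H →
      I.Act (boostedRule t b) (I.stageAt (boostedRule t b) y) q)
    (h₁ : I.DistLE a₁ v q₁) (h₂ : I.DistLE a₂ v q₂) (h₃ : I.DistLE a₃ v q₃)
    (h₁₂ : a₁ ≤ a₂) (h₁₃ : a₁ ≤ a₃) :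
    2 * I.excess (boostedRule t b) H {q₁, q₂, q₃} ≤ a₁ + a₂ + a₃ + β * a₁ := by
  have hf := hasFingerprint_boostedRule t b
  have hF := hasFingerprint_foreverRule b v
  set R := boostedRule t b with hR
  set F := foreverRule b v with hFdef
  have hd : ∀ q a, (q = q₁ ∧ a = a₁) ∨ (q = q₂ ∧ a = a₂) ∨ (q = q₃ ∧ a = a₃) →
      q ∈ ({q₁, q₂, q₃} : Finset V) ∧ I.DistLE a v q := by
    rintro q a (⟨rfl, rfl⟩ | ⟨rfl, rfl⟩ | ⟨rfl, rfl⟩) <;> simp [*]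
  have hβa : 0 ≤ β * a₁ := mul_nonneg hβ h₁.nonneg
  -- If the given run already connects `v` to the near terminals, only the late arrivals of `q₂` and
  -- `q₃` contribute to the excess.
  have htriv : (∀ y, 0 < y → y < H → a₁ / 2 < y → ∀ q ∈ near q₁ q₂ q₃ (a₂ / 2) (a₃ / 2) y,
      I.Conn R (I.stageAt R y) v q) →
      2 * I.excess R H {q₁, q₂, q₃} ≤ a₁ + a₂ + a₃ + β * a₁ := by
    intro h
    have := excess_le_add (I := I) (R := R) (X := {q₁, q₂, q₃}) hH
      (by linarith [h₂.nonneg] : 0 ≤ a₂ / 2) (by linarith [h₃.nonneg] : 0 ≤ a₃ / 2)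
      fun y hy0 hyH => touched_triple_sub_one_le (x₁ := a₁ / 2) (by linarith) (by linarith)
        fun hy q hq => (h y hy0 hyH hy q₁ (by simp [near])).symm.trans (h y hy0 hyH hy q hq)
    linarith [h₁.nonneg]
  have hnear : ∀ y, a₁ / 2 < y → ∀ q ∈ near q₁ q₂ q₃ (a₂ / 2) (a₃ / 2) y, ∃ a,
      ((q = q₁ ∧ a = a₁) ∨ (q = q₂ ∧ a = a₂) ∨ (q = q₃ ∧ a = a₃)) ∧ a / 2 < y := by
    intro y hy q hq
    simp only [near, Finset.mem_insert, Finset.mem_singleton] at hq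
    rcases hq with rfl | hq | hq
    · exact ⟨a₁, Or.inl ⟨rfl, rfl⟩, hy⟩
    · split_ifs at hq with h
      · exact ⟨a₁, Or.inl ⟨hq, rfl⟩, hy⟩
      · exact ⟨a₂, Or.inr (Or.inl ⟨hq, rfl⟩), not_le.1 h⟩
    · split_ifs at hq with h
      · exact ⟨a₁, Or.inl ⟨hq, rfl⟩, hy⟩
      · exact ⟨a₃, Or.inr (Or.inr ⟨hq, rfl⟩), not_le.1 h⟩
  have hactv : ∀ y, 0 ≤ y → I.Act F (I.stageAt F y) v := fun y hy =>
    (hF.act_stageAt_iff hy).2 ⟨v, Conn.refl _ _, by simp⟩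
  have hactq : ∀ q ∈ ({q₁, q₂, q₃} : Finset V), ∀ y, 0 ≤ y → y < H →
      I.Act F (I.stageAt F y) q := fun q hq y hy hyH =>
    hf.act_mono hF hy (fun z x _ hx => by
      by_cases hz : z = v
      · subst hz; simp
      · simpa [hz] using hx) (hact q hq y hy hyH)
  have hconnF : ∀ q a, (q = q₁ ∧ a = a₁) ∨ (q = q₂ ∧ a = a₂) ∨ (q = q₃ ∧ a = a₃) →
      ∀ y, y ≤ H → a / 2 < y → I.Conn F (I.stageAt F y) v q := by
    intro q a hqa y hyH hy
    obtain ⟨hq, hdist⟩ := hd q a hqa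
    by_contra hcon
    have := two_mul_le_of_not_conn (by linarith [hdist.nonneg]) (fun x hx _ => hactv x hx)
      (fun x hx hxy => hactq q hq x hx (hxy.trans_le hyH)) hcon hdist
    linarith
  -- The boost goes up to the first stage of the forever run at which `v` is connected to all
  -- terminals with `a / 2 < H`.
  have hex : ∃ n, ∀ q a, (q = q₁ ∧ a = a₁) ∨ (q = q₂ ∧ a = a₂) ∨ (q = q₃ ∧ a = a₃) →
      a / 2 < H → I.Conn F n v q :=
    ⟨I.stageAt F H, fun q a hqa ha => hconnF q a hqa H le_rfl ha⟩
  have hspec := Nat.find_spec hex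
  have hmin := fun m => Nat.find_min hex (m := m)
  generalize Nat.find hex = N at hspec hmin
  obtain _ | m := N
  -- All runs start in the same state, so connections at stage 0 hold for `R` too.
  · refine htriv fun y hy0 hyH hy q hq => ?_
    obtain ⟨a, hqa, ha⟩ := hnear y hy q hq
    exact Conn.mono (Nat.zero_le _) (show I.Conn R 0 v q from hspec q a hqa (ha.trans hyH))
  · obtain ⟨q, a, hqa, haH, hncon⟩ : ∃ q a, ((q = q₁ ∧ a = a₁) ∨ (q = q₂ ∧ a = a₂) ∨
        (q = q₃ ∧ a = a₃)) ∧ a / 2 < H ∧ ¬ I.Conn F m v q := by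
      have := hmin m (Nat.lt_succ_self m)
      push Not at this
      exact this
    have hm : m + 1 ≤ I.lastStage F := by
      by_contra hcon
      apply hncon
      have h := hspec q a hqa haH
      unfold Conn at h ⊢
      rwa [I.stage_of_le F (by omega), ← I.stage_of_le F (by omega : _ ≤ m)] at h
    obtain ⟨σ, hσ⟩ : ∃ σ, I.moment F (m + 1) = σ := ⟨_, rfl⟩
    -- The terminal `q` is missing until `σ`, yet `hconnF` connects it right after `a / 2`.
    have hσa : σ ≤ a / 2 := by
      by_contra hcon
      rw [not_le] at hcon
      obtain ⟨y, hy1, hy2⟩ := exists_between (lt_min hcon haH)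
      have h0 : 0 ≤ y := by linarith [(hd q a hqa).2.nonneg]
      have hlt := I.stageAt_lt F h0 (hy2.trans_le ((min_le_left _ _).trans hσ.ge))
      exact hncon ((hconnF q a hqa y (hy2.le.trans (min_le_right _ _)) hy1).mono (by omega))
    have hσ0 : 0 ≤ σ := hσ ▸ I.moment_nonneg F _
    have hσN : I.stageAt F σ = m + 1 := hσ ▸ I.stageAt_moment F hm
    have hmσ : I.moment F m < σ := hσ ▸ I.moment_lt_succ F (by omega)
    -- Up to `σ`, a fingerprint that is at least `b`, and at least `σ` at `v`, acts like the
    -- infinite one, so all connections carry over. This serves both the present run, if `σ ≤ b v`,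
    -- and the boosted one.
    have htrans : ∀ (R' : MoatRule V) (g : V → EReal), HasFingerprint R' g →
        (∀ z, (b z : EReal) ≤ g z) → (σ : EReal) ≤ g v → ∀ y, 0 < y → y < H → a₁ / 2 < y →
        ∀ q ∈ near q₁ q₂ q₃ (a₂ / 2) (a₃ / 2) y, I.Conn R' (I.stageAt R' y) v q := by
      intro R' g hg hbg hσg y hy0 hyH hy q hq
      obtain ⟨a, hqa, ha⟩ := hnear y hy q hq
      have hle : ∀ x, 0 ≤ x → x ≤ σ → I.Conn F (I.stageAt F x) v q →
          I.Conn R' (I.stageAt R' x) v q := by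
        intro x hx hxσ h
        refine hF.conn_mono hg hx (fun z w hw hwz => ?_) h
        by_cases hz : z = v
        · subst hz
          exact lt_of_lt_of_le (by exact_mod_cast hw.trans_le hxσ) hσg
        · rw [Function.update_of_ne hz] at hwz
          exact hwz.trans_le (hbg z)
      rcases le_total y σ with hyσ | hσy
      · exact hle y hy0.le hyσ (hconnF q a hqa y hyH.le ha)
      · exact (hle σ hσ0 le_rfl (hσN ▸ hspec q a hqa (ha.trans hyH))).stageAt_mono hσy
    rcases le_or_gt σ (b v) with hσb | hσb
    · exact htriv (htrans R _ hf (fun z => le_rfl) (by exact_mod_cast hσb))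
    -- At stage `m` the missing terminal `q` is in an active set other than that of `v`, because its
    -- start precedes `H`; the two sets merge at `σ`.
    · have hcand : I.IsBoostCandidate b v σ := by
        refine ⟨hσb, m, hσ, I.component (I.stage F m) q, ?_, ?_, ?_⟩
        · have := hactq q (hd q a hqa).1 _ (I.moment_nonneg F m) (by linarith)
          rwa [I.stageAt_moment F (by omega)] at this
        · exact fun h => hncon (component_eq_iff_conn.1 h).symm
        · intro w hw
          exact mem_component_iff.2 ((hspec q a hqa haH).trans
            ((mem_component_iff.1 hw).mono m.le_succ))
      have hval := hloc v σ hcand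
      rw [Valuable, win, loss, not_le] at hval
      -- With `x_i = a_i / 2` the balance allows `(a₂ + a₃ + (1 + β) * a₁) / 2`. As the boost is not
      -- valuable, the weighted total strictly increases, so the excess stays below this amount.
      have hmain := excess_add_le_of_conn (I := I) (t := t) hβ hσb.le (by linarith : σ ≤ H) hH
        (by linarith [h₁.nonneg] : 0 ≤ a₁ / 2) (by linarith : a₁ / 2 ≤ a₂ / 2)
        (by linarith : a₁ / 2 ≤ a₃ / 2) hact
        (htrans _ _ (hasFingerprint_boostedRule t (Function.update b v σ)) (fun z => by
          by_cases hz : z = v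
          · subst hz; simpa using hσb.le
          · simp [hz]) (by simp))
      linarith

end Star

end

end SteinerForest

namespace SteinerForest

noncomputable section

open scoped Classical

variable {V : Type*}

/-! ### Decomposing trees into stars -/

/-- The properties of `excess` used for the decomposition of trees: connecting `A` and `B`
separately suffices to connect `A ∪ B` if they share a vertex, and terminals of a star merge
early. -/
structure IsStarBounded (I : SteinerForest V) (S : Finset V) (β : ℝ) (J : Finset V → ℝ) :
    Prop where
  singleton : ∀ u ∈ S, J {u} = 0
  union : ∀ A B, (A ∩ B).Nonempty → J (A ∪ B) ≤ J A + J B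
  star : ∀ v, ∀ q₁ ∈ S, ∀ q₂ ∈ S, ∀ q₃ ∈ S, ∀ a₁ a₂ a₃, I.DistLE a₁ v q₁ → I.DistLE a₂ v q₂ →
    I.DistLE a₃ v q₃ → a₁ ≤ a₂ → a₁ ≤ a₃ → 2 * J {q₁, q₂, q₃} ≤ a₁ + a₂ + a₃ + β * a₁

/-- The terminals `X` are spanned by a tree of cost `c` with root `v`. The tree splits at `v` into
two parts, with terminals `X₁` and `X₂`, that have terminals at distance `a₁` and `a₂` from `v`. -/
def SplitsAt (I : SteinerForest V) (β : ℝ) (J : Finset V → ℝ) (v : V) (X : Finset V) (c : ℝ) :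
    Prop :=
  ∃ X₁ X₂ q₁ q₂ a₁ a₂, q₁ ∈ X₁ ∧ q₂ ∈ X₂ ∧ X = X₁ ∪ X₂ ∧ I.DistLE a₁ v q₁ ∧ I.DistLE a₂ v q₂ ∧
    a₁ ≤ a₂ ∧
    2 * (2 * J X + J X₁ + J X₂) + a₁ + a₂ ≤ (5 + β) * c - 2 * (2 + β) * a₁

/-- The terminals `X` are empty or spanned by a tree of cost at most `c` that contains `x`. -/
def SpannedFrom (I : SteinerForest V) (S : Finset V) (β : ℝ) (J : Finset V → ℝ) (x : V)
    (X : Finset V) (c : ℝ) : Prop :=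
  0 ≤ c ∧ (X.Nonempty → X ⊆ S ∧ ∃ v e c', I.DistLE e x v ∧ SplitsAt I β J v X c' ∧ e + c' ≤ c)

variable {I : SteinerForest V} {S : Finset V} {β : ℝ} {J : Finset V → ℝ}

/-- The smallest distance bears the factor `β`, so charging it to any other leaf only weakens the
bound. -/
theorem IsStarBounded.star' (hJ : IsStarBounded I S β J) (hβ : 0 ≤ β) {v q₁ q₂ q₃ : V}
    (h₁ : q₁ ∈ S) (h₂ : q₂ ∈ S) (h₃ : q₃ ∈ S) {a₁ a₂ a₃ : ℝ} (d₁ : I.DistLE a₁ v q₁)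
    (d₂ : I.DistLE a₂ v q₂) (d₃ : I.DistLE a₃ v q₃) :
    2 * J {q₁, q₂, q₃} ≤ a₁ + a₂ + a₃ + β * a₁ := by
  have e2 : ({q₁, q₂, q₃} : Finset V) = {q₂, q₁, q₃} := Finset.insert_comm _ _ _
  have e3 : ({q₁, q₂, q₃} : Finset V) = {q₃, q₁, q₂} := by
    ext; simp; tauto
  rcases le_total a₁ a₂ with h12 | h12 <;> rcases le_total a₁ a₃ with h13 | h13
  · exact hJ.star v q₁ h₁ q₂ h₂ q₃ h₃ a₁ a₂ a₃ d₁ d₂ d₃ h12 h13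
  · have := hJ.star v q₃ h₃ q₁ h₁ q₂ h₂ a₃ a₁ a₂ d₃ d₁ d₂ h13 (h13.trans h12)
    rw [e3]
    linarith [mul_le_mul_of_nonneg_left h13 hβ]
  · have := hJ.star v q₂ h₂ q₁ h₁ q₃ h₃ a₂ a₁ a₃ d₂ d₁ d₃ h12 (h12.trans h13)
    rw [e2]
    linarith [mul_le_mul_of_nonneg_left h12 hβ]
  · rcases le_total a₂ a₃ with h23 | h23
    · have := hJ.star v q₂ h₂ q₁ h₁ q₃ h₃ a₂ a₁ a₃ d₂ d₁ d₃ h12 h23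
      rw [e2]
      linarith [mul_le_mul_of_nonneg_left h12 hβ]
    · have := hJ.star v q₃ h₃ q₁ h₁ q₂ h₂ a₃ a₁ a₂ d₃ d₁ d₂ h13 h23
      rw [e3]
      linarith [mul_le_mul_of_nonneg_left h13 hβ]

theorem IsStarBounded.le_triple (hJ : IsStarBounded I S β J) {A B C : Finset V} {p q r : V}
    (hp : p ∈ A) (hq : q ∈ B) (hr : r ∈ C) : J (A ∪ B ∪ C) ≤ J {p, q, r} + J A + J B + J C := by
  have h1 := hJ.union {p, q, r} A ⟨p, by simp [hp]⟩
  have h2 := hJ.union ({p, q, r} ∪ A) B ⟨q, by simp [hq]⟩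
  have h3 := hJ.union ({p, q, r} ∪ A ∪ B) C ⟨r, by simp [hr]⟩
  have e : {p, q, r} ∪ A ∪ B ∪ C = A ∪ B ∪ C := by
    ext x
    simp only [Finset.mem_union, Finset.mem_insert, Finset.mem_singleton]
    constructor
    · rintro (((((rfl | rfl | rfl)) | h) | h) | h) <;> tauto
    · tauto
  rw [e] at h3
  linarith

theorem IsStarBounded.le_pair (hJ : IsStarBounded I S β J) {A B : Finset V} {p q : V}
    (hp : p ∈ A) (hq : q ∈ B) : J (A ∪ B) ≤ J {p, q} + J A + J B := by
  have h1 := hJ.union {p, q} A ⟨p, by simp [hp]⟩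
  have h2 := hJ.union ({p, q} ∪ A) B ⟨q, by simp [hq]⟩
  have e : {p, q} ∪ A ∪ B = A ∪ B := by
    ext x
    simp only [Finset.mem_union, Finset.mem_insert, Finset.mem_singleton]
    constructor
    · rintro ((((rfl | rfl)) | h) | h) <;> tauto
    · tauto
  rw [e] at h2
  linarith

/-- A degenerate star centred at `p` with two leaves at distance 0; the `β` term vanishes. -/
theorem IsStarBounded.pair (hJ : IsStarBounded I S β J) {v p q : V} (hp : p ∈ S) (hq : q ∈ S)
    {a a' : ℝ} (d : I.DistLE a v p) (d' : I.DistLE a' v q) : 2 * J {p, q} ≤ a + a' := by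
  have h := hJ.star p p hp p hp q hq 0 0 (a + a') (DistLE.refl p) (DistLE.refl p)
    (d.symm.trans d') le_rfl (add_nonneg d.nonneg d'.nonneg)
  rw [Finset.insert_eq_of_mem (by simp)] at h
  linarith

theorem SpannedFrom.empty {x : V} : SpannedFrom I S β J x ∅ 0 := ⟨le_rfl, by simp⟩

theorem SpannedFrom.singleton (hJ : IsStarBounded I S β J) {x : V} (hx : x ∈ S) :
    SpannedFrom I S β J x {x} 0 := by
  refine ⟨le_rfl, fun _ => ⟨by simpa using hx, x, 0, 0, DistLE.refl x, ?_, by simp⟩⟩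
  exact ⟨{x}, {x}, x, x, 0, 0, by simp, by simp, by simp, DistLE.refl x, DistLE.refl x, le_rfl,
    by simp [hJ.singleton x hx]⟩

theorem SpannedFrom.edge {x y : V} {X : Finset V} {c : ℝ} (h : SpannedFrom I S β J y X c)
    (hadj : I.graph.Adj x y) : SpannedFrom I S β J x X (I.cost s(x, y) + c) := by
  refine ⟨add_nonneg (I.cost_nonneg _ hadj) h.1, fun hX => ?_⟩
  obtain ⟨hXS, v, e, c', hd, hsp, hle⟩ := h.2 hX
  exact ⟨hXS, v, I.cost s(x, y) + e, c', (DistLE.of_adj hadj).trans hd, hsp, by linarith⟩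

/-- Adding the two ways of connecting `X ∪ Y` and inserting both invariants leaves `(5 + β) * (c +
c') + 3 * (e + e') - (2 + β) * (a₁ + b₁)`, including the new distances `e + a₁` and `e' + b₁`. The
required bound then says that twice the smaller new distance is at most their sum, times `2 + β`. -/
theorem SplitsAt.join (hJ : IsStarBounded I S β J) (hβ : 0 ≤ β) {x v w : V} {X Y : Finset V}
    {e e' c c' : ℝ} (hX : X ⊆ S) (hY : Y ⊆ S) (hv : I.DistLE e x v) (hw : I.DistLE e' x w)
    (h : SplitsAt I β J v X c) (h' : SplitsAt I β J w Y c') :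
    SplitsAt I β J x (X ∪ Y) (e + c + (e' + c')) := by
  obtain ⟨X₁, X₂, q₁, q₂, a₁, a₂, hq₁, hq₂, rfl, hd₁, hd₂, ha, hle⟩ := h
  obtain ⟨Y₁, Y₂, p₁, p₂, b₁, b₂, hp₁, hp₂, rfl, hd₁', hd₂', hb, hle'⟩ := h'
  have hq₁S := hX (Finset.mem_union_left _ hq₁)
  have hq₂S := hX (Finset.mem_union_right _ hq₂)
  have hp₁S := hY (Finset.mem_union_left _ hp₁)
  have hp₂S := hY (Finset.mem_union_right _ hp₂)
  -- The stars are centred at the old roots `v` and `w`. The third leaf is the nearer representative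
  -- of the other side, reached through `x`.
  have s1 := hJ.star' hβ hq₁S hq₂S hp₁S hd₁ hd₂ (hv.symm.trans (hw.trans hd₁'))
  have s2 := hJ.star' hβ hp₁S hp₂S hq₁S hd₁' hd₂' (hw.symm.trans (hv.trans hd₁))
  have t1 := hJ.le_triple hq₁ hq₂ (Finset.mem_union_left Y₂ hp₁)
  have t2 := hJ.le_triple hp₁ hp₂ (Finset.mem_union_left X₂ hq₁)
  rw [Finset.union_comm (Y₁ ∪ Y₂)] at t2
  have hmul := mul_nonneg (by linarith : 0 ≤ 2 + β)
    (sub_nonneg.2 (min_le_left (e + a₁) (e' + b₁)))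
  have hmul' := mul_nonneg (by linarith : 0 ≤ 2 + β)
    (sub_nonneg.2 (min_le_right (e + a₁) (e' + b₁)))
  rcases le_total (e + a₁) (e' + b₁) with hm | hm
  · refine ⟨X₁ ∪ X₂, Y₁ ∪ Y₂, q₁, p₁, e + a₁, e' + b₁, Finset.mem_union_left _ hq₁,
      Finset.mem_union_left _ hp₁, rfl, hv.trans hd₁, hw.trans hd₁', hm, ?_⟩
    rw [min_eq_left hm] at hmul'
    linarith
  · refine ⟨Y₁ ∪ Y₂, X₁ ∪ X₂, p₁, q₁, e' + b₁, e + a₁, Finset.mem_union_left _ hp₁,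
      Finset.mem_union_left _ hq₁, Finset.union_comm _ _, hw.trans hd₁', hv.trans hd₁, hm, ?_⟩
    rw [min_eq_right hm] at hmul
    linarith

theorem SpannedFrom.join (hJ : IsStarBounded I S β J) (hβ : 0 ≤ β) {x : V} {X Y : Finset V}
    {c c' : ℝ} (h : SpannedFrom I S β J x X c) (h' : SpannedFrom I S β J x Y c') :
    SpannedFrom I S β J x (X ∪ Y) (c + c') := by
  refine ⟨add_nonneg h.1 h'.1, fun _ => ?_⟩
  rcases X.eq_empty_or_nonempty with rfl | hX
  · rcases Y.eq_empty_or_nonempty with rfl | hY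
    · simp_all
    · obtain ⟨hYS, v, e, c'', hd, hsp, hle⟩ := h'.2 hY
      exact ⟨by simpa using hYS, v, e, c'', hd, by simpa using hsp, by linarith [h.1]⟩
  · obtain ⟨hXS, v, e, d, hd, hsp, hle⟩ := h.2 hX
    rcases Y.eq_empty_or_nonempty with rfl | hY
    · exact ⟨by simpa using hXS, v, e, d, hd, by simpa using hsp, by linarith [h'.1]⟩
    · obtain ⟨hYS, w, e', d', hd', hsp', hle'⟩ := h'.2 hY
      exact ⟨Finset.union_subset hXS hYS, x, 0, _, DistLE.refl x,
        hsp.join hJ hβ hXS hYS hd hd' hsp', by linarith⟩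

/-- The invariant bounds `4 * J X + 2 * J X₁ + 2 * J X₂`. Linking the parts by a path bounds the
missing `2 * J X` by `2 * J X₁ + 2 * J X₂` minus those same terms, plus `a₁ + a₂`, which the
invariant provides. -/
theorem SpannedFrom.six_mul_le (hJ : IsStarBounded I S β J) (hβ : 0 ≤ β) {x : V} {X : Finset V}
    {c : ℝ} (h : SpannedFrom I S β J x X c) (hX : X.Nonempty) : 6 * J X ≤ (5 + β) * c := by
  obtain ⟨hXS, v, e, c', hd, ⟨X₁, X₂, q₁, q₂, a₁, a₂, hq₁, hq₂, rfl, hd₁, hd₂, ha, hle⟩, hc⟩ :=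
    h.2 hX
  have h1 := hJ.le_pair hq₁ hq₂
  have h2 := hJ.pair (hXS (Finset.mem_union_left _ hq₁)) (hXS (Finset.mem_union_right _ hq₂))
    hd₁ hd₂
  have h3 := mul_nonneg (by linarith : 0 ≤ 2 + β) hd₁.nonneg
  have h4 := mul_le_mul_of_nonneg_left (by linarith [hd.nonneg] : c' ≤ c)
    (by linarith : 0 ≤ 5 + β)
  linarith

theorem SpannedFrom.mono {x : V} {X : Finset V} {c c' : ℝ} (h : SpannedFrom I S β J x X c)
    (hc : c ≤ c') : SpannedFrom I S β J x X c' := by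
  refine ⟨h.1.trans hc, fun hX => ?_⟩
  obtain ⟨hXS, v, e, d, hd, hsp, hle⟩ := h.2 hX
  exact ⟨hXS, v, e, d, hd, hsp, hle.trans hc⟩

/-- A vertex that is adjacent to a vertex outside of `z` can be split off the edge costs. -/
theorem sum_edges_induce_add_le {W : Type*} [Fintype W] (G : SimpleGraph W) (f : Sym2 W → ℝ)
    (hf : ∀ e ∈ G.edgeSet, 0 ≤ f e) {y z : W} (h : G.Adj y z) :
    ∑ e : Sym2 ({z}ᶜ : Set W) with e ∈ (G.induce ({z}ᶜ : Set W)).edgeSet,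
        f (e.map Subtype.val) + f s(y, z) ≤ ∑ e : Sym2 W with e ∈ G.edgeSet, f e := by
  have hinj : Function.Injective (Sym2.map (Subtype.val : ({z}ᶜ : Set W) → W)) :=
    Sym2.map.injective Subtype.val_injective
  rw [← Finset.sum_image (f := f) (g := Sym2.map (Subtype.val : ({z}ᶜ : Set W) → W))
    fun a _ a' _ h => hinj h, add_comm, ← Finset.sum_insert]
  · refine Finset.sum_le_sum_of_subset_of_nonneg ?_ fun e he _ => hf e (Finset.mem_filter.1 he).2
    intro e he
    rw [Finset.mem_insert, Finset.mem_image] at he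
    rw [Finset.mem_filter]
    refine ⟨Finset.mem_univ _, ?_⟩
    rcases he with rfl | ⟨e', he', rfl⟩
    · exact h
    · have := (Finset.mem_filter.1 he').2
      induction e' with
      | _ a b => exact this
  · rw [Finset.mem_image]
    rintro ⟨e', -, he'⟩
    have hz : z ∈ e'.map (Subtype.val : ({z}ᶜ : Set W) → W) := by rw [he']; simp
    obtain ⟨a, -, ha⟩ := Sym2.mem_map.1 hz
    exact a.2 ha

/-- Induction by deleting a vertex `z` that does not disconnect `G`: its branch is extended by one
edge and joined to that of a neighbour `y`. Carrying arbitrary branches `X a` of cost `c a` makes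
the induction go through. -/
theorem exists_spannedFrom_of_connected (hJ : IsStarBounded I S β J) (hβ : 0 ≤ β) (n : ℕ) :
    ∀ {W : Type _} [Fintype W] (G : SimpleGraph W) (φ : W → V), Fintype.card W = n →
      G.Connected → (∀ a b, G.Adj a b → I.graph.Adj (φ a) (φ b)) →
      ∀ (X : W → Finset V) (c : W → ℝ), (∀ a, SpannedFrom I S β J (φ a) (X a) (c a)) →
      ∃ r, SpannedFrom I S β J r (Finset.univ.biUnion X)
        (∑ a, c a + ∑ e : Sym2 W with e ∈ G.edgeSet, I.cost (e.map φ)) := by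
  induction n with
  | zero =>
    intro W _ G φ hn hG
    have := hG.nonempty
    exact absurd hn Fintype.card_ne_zero
  | succ n ih =>
    intro W _ G φ hn hG hφ X c hX
    have hcost : ∀ e ∈ G.edgeSet, 0 ≤ I.cost (e.map φ) := by
      intro e he
      induction e with
      | _ a b => exact I.cost_nonneg _ (hφ a b he)
    rcases subsingleton_or_nontrivial W with hW | hW
    · obtain ⟨a⟩ := hG.nonempty
      refine ⟨φ a, ?_⟩
      have huniv : (Finset.univ : Finset W) = {a} := by
        ext b; simp [Subsingleton.elim b a]
      have hsum : ∑ e : Sym2 W with e ∈ G.edgeSet, I.cost (e.map φ) = 0 := by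
        refine Finset.sum_eq_zero fun e he => ?_
        induction e with
        | _ x y =>
          have : G.Adj x y := (Finset.mem_filter.1 he).2
          exact absurd (Subsingleton.elim x y) this.ne
      rw [huniv, hsum]
      simpa using hX a
    · obtain ⟨z, hz⟩ := hG.exists_connected_induce_compl_singleton_of_finite_nontrivial
      obtain ⟨y, hzy⟩ := hG.preconnected.exists_adj_of_nontrivial z
      have hyz : y ∈ ({z}ᶜ : Set W) := by simpa using hzy.ne'
      have hadj : I.graph.Adj (φ y) (φ z) := hφ _ _ hzy.symm
      obtain ⟨r, hr⟩ := ih (G.induce ({z}ᶜ : Set W)) (fun a => φ a)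
        (by rw [Fintype.card_compl_set]; simp [hn]) hz (fun a b h => hφ _ _ h)
        (fun a => if (a : W) = y then X y ∪ X z else X a)
        (fun a => if (a : W) = y then c y + (I.cost s(φ y, φ z) + c z) else c a)
        (fun a => by
          by_cases hay : (a : W) = y
          · simp only [hay, if_true]
            exact (hX y).join hJ hβ ((hX z).edge hadj)
          · simp only [hay, if_false]
            exact hX a)
      have hbi : (Finset.univ.biUnion fun a : ({z}ᶜ : Set W) =>
          if (a : W) = y then X y ∪ X z else X a) = Finset.univ.biUnion X := by
        ext x
        simp only [Finset.mem_biUnion, Finset.mem_univ, true_and]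
        constructor
        · rintro ⟨a, ha⟩
          split_ifs at ha with hay
          · rcases Finset.mem_union.1 ha with h | h
            · exact ⟨y, h⟩
            · exact ⟨z, h⟩
          · exact ⟨a, ha⟩
        · rintro ⟨a, ha⟩
          by_cases haz : a = z
          · exact ⟨⟨y, hyz⟩, by simp [← haz, ha]⟩
          · refine ⟨⟨a, haz⟩, ?_⟩
            split_ifs with hay
            · subst hay
              exact Finset.mem_union_left _ ha
            · exact ha
      have hsum : ∑ a : ({z}ᶜ : Set W),
          (if (a : W) = y then c y + (I.cost s(φ y, φ z) + c z) else c a) =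
          ∑ a, c a + I.cost s(φ y, φ z) := by
        rw [← Finset.sum_subtype (Finset.univ.erase z) (p := (· ∈ ({z}ᶜ : Set W))) (by simp)
          fun a => if a = y then c y + (I.cost s(φ y, φ z) + c z) else c a,
          ← Finset.add_sum_erase Finset.univ c (Finset.mem_univ z),
          ← Finset.add_sum_erase _ c (Finset.mem_erase.2 ⟨hzy.ne', Finset.mem_univ y⟩),
          ← Finset.add_sum_erase _ _ (Finset.mem_erase.2 ⟨hzy.ne', Finset.mem_univ y⟩), if_pos rfl,
          Finset.sum_congr rfl fun a ha => if_neg (Finset.ne_of_mem_erase ha)]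
        ring
      have hedge := sum_edges_induce_add_le G (fun e => I.cost (e.map φ)) hcost hzy.symm
      rw [hbi] at hr
      refine ⟨r, hr.mono ?_⟩
      rw [hsum]
      simp only [Sym2.map_map, Sym2.map_mk] at hedge
      have : (φ ∘ Subtype.val : ({z}ᶜ : Set W) → V) = fun a => φ a.1 := rfl
      rw [this] at hedge
      rw [add_assoc]
      refine add_le_add le_rfl ?_
      rw [add_comm]
      refine le_trans (le_of_eq ?_) hedge
      congr!

end

end SteinerForest

namespace SteinerForest

noncomputable section

open scoped Classical

variable {V : Type*} [Fintype V] {I : SteinerForest V} {R : MoatRule V}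

/-! ### Assignments and the final bound -/

theorem touched_union_add_one_le {n : ℕ} {A B : Finset V} (h : (A ∩ B).Nonempty) :
    I.touched R n (A ∪ B) + 1 ≤ I.touched R n A + I.touched R n B := by
  obtain ⟨u, hu⟩ := h
  rw [Finset.mem_inter] at hu
  have h1 := Finset.card_union_add_card_inter (A.image (I.component (I.stage R n)))
    (B.image (I.component (I.stage R n)))
  have h2 : 0 < (A.image (I.component (I.stage R n)) ∩
      B.image (I.component (I.stage R n))).card :=
    Finset.card_pos.2 ⟨_, Finset.mem_inter.2
      ⟨Finset.mem_image_of_mem _ hu.1, Finset.mem_image_of_mem _ hu.2⟩⟩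
  unfold touched
  rw [Finset.image_union]
  omega

theorem excess_singleton (H : ℝ) (u : V) : I.excess R H {u} = 0 := by simp [excess, touched]

theorem excess_union_le {H : ℝ} (hH : 0 ≤ H) {A B : Finset V} (h : (A ∩ B).Nonempty) :
    I.excess R H (A ∪ B) ≤ I.excess R H A + I.excess R H B := by
  have hint : ∀ X, IntervalIntegrable (fun y => (I.touched R (I.stageAt R y) X : ℝ) - 1)
      volume 0 H := fun X =>
    I.intervalIntegrable_stageAt R (fun n => (I.touched R n X : ℝ) - 1) 0 H
  unfold excess
  rw [← intervalIntegral.integral_add (hint A) (hint B)]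
  refine intervalIntegral.integral_mono_on_of_le_Ioo hH (hint _) ((hint A).add (hint B))
    fun y _ => ?_
  have : (I.touched R (I.stageAt R y) (A ∪ B) : ℝ) + 1 ≤
      I.touched R (I.stageAt R y) A + I.touched R (I.stageAt R y) B := by
    exact_mod_cast touched_union_add_one_le h
  linarith

theorem excess_moment {n : ℕ} (hn : n ≤ I.lastStage R) (X : Finset V) :
    I.excess R (I.moment R n) X =
      ∑ k ∈ Finset.range n, (I.moment R (k + 1) - I.moment R k) * ((I.touched R k X : ℝ) - 1) :=
  I.integral_stageAt_moment R (fun k => (I.touched R k X : ℝ) - 1) hn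

theorem not_priorityLT_of_priorityLT {rank : V → ℕ} {u v : V} (h : I.PriorityLT rank u v) :
    ¬ I.PriorityLT rank v u := by
  unfold PriorityLT at h ⊢
  rintro (h' | h') <;> rcases h with h | h
  · linarith
  · linarith [h.1]
  · linarith [h'.1]
  · omega

theorem exists_highest_priority {rank : V → ℕ} {S : Finset V} (hS : S.Nonempty) :
    ∃ v ∈ S, ∀ u ∈ S, ¬ I.PriorityLT rank v u := by
  obtain ⟨v, hv, hmax⟩ := S.exists_max_image (fun v => toLex (I.legacyTime v, rank v)) hS
  refine ⟨v, hv, fun u hu h => ?_⟩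
  have := hmax u hu
  rw [Prod.Lex.toLex_le_toLex] at this
  unfold PriorityLT at h
  dsimp only at this
  rcases h with h | h <;> rcases this with h' | h'
  · linarith
  · linarith [h'.1]
  · linarith [h.1]
  · omega

/-- The total growth assigned to all vertices of `S` but one is bounded by the growth up to the
moment at which the vertices of `S` are connected. -/
theorem sum_assigned_sub_sup_le {rank : V → ℕ} {S : Finset V} (hS : S.Nonempty) {n : ℕ}
    (hn : n ≤ I.lastStage R) (hconn : ∀ u ∈ S, ∀ v ∈ S, I.Conn R n u v)
    {r : Finset V → V → ℝ} (hr : I.IsAssignment R r) (hrS : I.IsPriorityBased rank r S) :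
    ∑ v ∈ S, assigned r v - S.sup' hS (assigned r) ≤ I.excess R (I.moment R n) S := by
  obtain ⟨top, htop, hmax⟩ := exists_highest_priority (I := I) (rank := rank) hS
  have hlen : ∀ k, 0 ≤ I.moment R (k + 1) - I.moment R k := fun k =>
    sub_nonneg.2 (I.moment_le_succ R k)
  -- A set that gives growth to another vertex of `S` cannot contain the vertex of highest priority.
  have htopA : ∀ A, ∀ v ∈ S, v ≠ top → 0 < r A v → top ∉ A := fun A v hv hne hpos hmem =>
    hmax v hv ((hrS A v hv hpos).2 top htop hmem hne.symm)
  have hassigned : ∀ v ∈ S, v ≠ top → assigned r v ≤ ∑ k ∈ Finset.range n,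
      (I.moment R (k + 1) - I.moment R k) *
        if 0 < r (I.component (I.stage R k) v) v then 1 else 0 := by
    intro v hv hne
    have hA : ∀ A, r A v ≤ ∑ k ∈ Finset.range n, (I.moment R (k + 1) - I.moment R k) *
        if I.component (I.stage R k) v = A then (if 0 < r A v then 1 else 0) else 0 := by
      intro A
      rcases (hr A v).1.eq_or_lt with h0 | hpos
      · rw [← h0]
        simp
      · refine (hr A v).2.1.trans ?_
        rw [finalGrowth, growth_eq_sum]
        simp only [hpos, if_true]
        have hact : ∀ k, A ∈ I.activeSets R (I.stage R k) →
            I.component (I.stage R k) v = A := fun k hk =>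
          component_of_mem_activeSets hk (hrS A v hv hpos).1
        -- From stage `n` on, the component of `v` contains `top`, so `A` can no longer be active.
        rw [← Finset.sum_subset (Finset.range_mono hn)]
        · refine Finset.sum_le_sum fun k _ => mul_le_mul_of_nonneg_left ?_ (hlen k)
          by_cases hk : A ∈ I.activeSets R (I.stage R k)
          · rw [if_pos hk, if_pos (hact k hk)]
          · rw [if_neg hk]
            split_ifs <;> norm_num
        · intro k _ hk
          rw [Finset.mem_range, not_lt] at hk
          have : A ∉ I.activeSets R (I.stage R k) := fun h => htopA A v hv hne hpos <| by
            rw [← hact k h, mem_component_iff]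
            exact (hconn v hv top htop).mono hk
          rw [if_neg this, mul_zero]
    refine (Finset.sum_le_sum fun A _ => hA A).trans_eq ?_
    rw [Finset.sum_comm]
    refine Finset.sum_congr rfl fun k _ => ?_
    rw [← Finset.mul_sum, Finset.sum_ite_eq]
    simp
  -- Vertices receiving growth at stage `k` lie in different components, none of which contains
  -- `top`.
  have hcount : ∀ k, ∑ v ∈ S.erase top,
      (if 0 < r (I.component (I.stage R k) v) v then (1 : ℝ) else 0) ≤
        (I.touched R k S : ℝ) - 1 := by
    intro k
    rw [← Finset.sum_filter, Finset.sum_const, nsmul_eq_mul, mul_one, le_sub_iff_add_le]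
    have hmem : I.component (I.stage R k) top ∈ S.image (I.component (I.stage R k)) :=
      Finset.mem_image_of_mem _ htop
    have hself : ∀ v, v ∈ I.component (I.stage R k) v := fun v =>
      mem_component_iff.2 (Conn.refl _ _)
    have hle : ((S.erase top).filter fun v => 0 < r (I.component (I.stage R k) v) v).card ≤
        ((S.image (I.component (I.stage R k))).erase (I.component (I.stage R k) top)).card := by
      refine Finset.card_le_card_of_injOn (I.component (I.stage R k)) ?_ ?_
      · intro v hv
        obtain ⟨hv, hpos⟩ := Finset.mem_filter.1 (Finset.mem_coe.1 hv)
        obtain ⟨hne, hv⟩ := Finset.mem_erase.1 hv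
        refine Finset.mem_coe.2 (Finset.mem_erase.2 ⟨fun h => ?_, Finset.mem_image_of_mem _ hv⟩)
        exact htopA _ v hv hne hpos (h ▸ hself top)
      · intro v hv u hu h
        obtain ⟨hv, hpos⟩ := Finset.mem_filter.1 (Finset.mem_coe.1 hv)
        obtain ⟨hu, hpos'⟩ := Finset.mem_filter.1 (Finset.mem_coe.1 hu)
        have hv := Finset.mem_of_mem_erase hv
        have hu := Finset.mem_of_mem_erase hu
        by_contra hne
        exact not_priorityLT_of_priorityLT
          ((hrS _ v hv hpos).2 u hu (h ▸ hself u) (Ne.symm hne))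
          ((hrS _ u hu hpos').2 v hv (h ▸ hself v) hne)
    have h1 := Finset.card_erase_add_one hmem
    unfold touched
    exact_mod_cast (by omega : _ + 1 ≤ _)
  rw [excess_moment hn]
  -- The maximum is at least the share of `top`, so dropping `top` suffices.
  have hsup := Finset.le_sup' (assigned r) htop
  rw [← Finset.add_sum_erase S _ htop]
  have : ∑ v ∈ S.erase top, assigned r v ≤ ∑ k ∈ Finset.range n,
      (I.moment R (k + 1) - I.moment R k) * ((I.touched R k S : ℝ) - 1) := by
    refine (Finset.sum_le_sum fun v hv => hassigned v (Finset.mem_of_mem_erase hv)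
      (Finset.ne_of_mem_erase hv)).trans ?_
    rw [Finset.sum_comm]
    refine Finset.sum_le_sum fun k _ => ?_
    rw [← Finset.mul_sum]
    exact mul_le_mul_of_nonneg_left (hcount k) (hlen k)
  linarith

/-- A connected subgraph that contains `S` costs at least as much as its decomposition. -/
theorem six_mul_le_edgeCost {S : Finset V} {β : ℝ} {J : Finset V → ℝ}
    (hJ : IsStarBounded I S β J) (hβ : 0 ≤ β) (hS : S.Nonempty) {F : SimpleGraph V}
    (hF : F ≤ I.graph) (T : F.Subgraph) (hST : (S : Set V) ⊆ T.verts) (hT : T.coe.Connected) :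
    6 * J S ≤ (5 + β) * I.edgeCost T.edgeSet := by
  obtain ⟨x, hx⟩ := exists_spannedFrom_of_connected hJ hβ _ T.coe Subtype.val rfl hT
    (fun a b h => hF (T.adj_sub h)) (fun a => if (a : V) ∈ S then {(a : V)} else ∅) (fun _ => 0)
    (fun a => by
      split_ifs with h
      · exact SpannedFrom.singleton hJ h
      · exact SpannedFrom.empty)
  have hbi : (Finset.univ.biUnion fun a : T.verts => if (a : V) ∈ S then {(a : V)} else ∅) = S := by
    ext u
    simp only [Finset.mem_biUnion, Finset.mem_univ, true_and]
    constructor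
    · rintro ⟨a, ha⟩
      split_ifs at ha with h
      · rwa [Finset.mem_singleton.1 ha]
      · simp at ha
    · exact fun hu => ⟨⟨u, hST hu⟩, by simp [hu]⟩
  rw [hbi] at hx
  refine (hx.six_mul_le hJ hβ hS).trans (mul_le_mul_of_nonneg_left ?_ (by linarith))
  rw [Finset.sum_const_zero, zero_add, edgeCost,
    ← Finset.sum_image (f := I.cost) (g := Sym2.map (Subtype.val : T.verts → V))
      fun a _ a' _ h => Sym2.map.injective Subtype.val_injective h]
  refine Finset.sum_le_sum_of_subset_of_nonneg ?_ fun e he _ => ?_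
  · intro e he
    obtain ⟨e', he', rfl⟩ := Finset.mem_image.1 he
    refine Finset.mem_filter.2 ⟨Finset.mem_univ _, ?_⟩
    have := (Finset.mem_filter.1 he').2
    induction e' with
    | _ a b => exact this
  · have := (Finset.mem_filter.1 he).2
    exact I.cost_nonneg e (SimpleGraph.edgeSet_mono hF (T.edgeSet_subset this))

end

end SteinerForest

/-! ### The main theorem -/

theorem mainTheorem4 {V : Type*} [Fintype V] (I : SteinerForest V)
    (opt : SimpleGraph V) (hopt : I.IsOPT opt)
    (rank : V → ℕ) (hrank : I.IsTieBreaker rank)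
    (β : ℝ) (hβ0 : 0 < β) (hβ1 : β < 1)
    (t b : V → ℝ) (ht : ∀ v, 0 ≤ t v) (hb : I.IsLocalSearchOutput β t b)
    (S : Finset V) (hS : S.Nonempty)
    (hSopt : ∀ u ∈ S, ∀ v ∈ S, opt.Reachable u v)
    (hSact : I.ActivelyConnected (SteinerForest.boostedRule t b) S)
    (r : Finset V → V → ℝ) (hr : I.IsAssignment (SteinerForest.boostedRule t b) r)
    (hrS : I.IsPriorityBased rank r S)
    (T : opt.Subgraph) (hT : SteinerForest.IsMinimalSubtree opt S T) :
    6 / (5 + β) * (∑ v ∈ S, SteinerForest.assigned r v - S.sup' hS (SteinerForest.assigned r)) ≤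
      I.edgeCost T.edgeSet := by
  obtain ⟨n, hconn, hact⟩ := hSact
  -- Past the end, `S` would have been in active sets at the last stage, where none is active.
  have hn : n ≤ I.lastStage (SteinerForest.boostedRule t b) := by
    by_contra hcon
    obtain ⟨u, hu⟩ := hS
    have := hact _ (not_le.1 hcon) u hu
    rw [SteinerForest.activeSets_lastStage_boostedRule] at this
    exact Finset.notMem_empty _ this
  have hH := I.moment_nonneg (SteinerForest.boostedRule t b) n
  -- The horizon is the moment at which `S` is connected: before it all vertices of `S` are active,
  -- as the star bound demands.
  have hJ : SteinerForest.IsStarBounded I S β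
      (I.excess (SteinerForest.boostedRule t b) (I.moment (SteinerForest.boostedRule t b) n)) := by
    refine ⟨fun u _ => SteinerForest.excess_singleton _ u,
      fun A B h => ?_, fun v q₁ hq₁ q₂ hq₂ q₃ hq₃ a₁ a₂ a₃ d₁ d₂ d₃ h₁₂ h₁₃ => ?_⟩
    · convert SteinerForest.excess_union_le hH (A := A) (B := B) (by convert h)
    · convert SteinerForest.two_mul_excess_star_le hβ0.le hb.2 hH
        (fun q hq y hy hyH => hact _ (I.stageAt_lt _ hy hyH) q ?_) d₁ d₂ d₃ h₁₂ h₁₃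
      simp only [Finset.mem_insert, Finset.mem_singleton] at hq
      rcases hq with rfl | rfl | rfl <;> assumption
  have h1 := SteinerForest.six_mul_le_edgeCost hJ hβ0.le hS hopt.1.1 T hT.prop.1 hT.prop.2.connected
  have h2 := SteinerForest.sum_assigned_sub_sup_le hS hn
    (fun u hu v hv => SteinerForest.component_eq_iff_conn.1 (hconn u hu v hv)) hr hrS
  rw [div_mul_eq_mul_div, div_le_iff₀ (by linarith)]
  linarith
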